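/- Let $q\in\mathbb{C}$ with $0<|q|<1$. Write $(x;q)_\infty=\prod_{i\ge 0}(1-q^ix)$, $j(x;q)=(x;q)_\infty(q/x;q)_\infty(q;q)_\infty$, $J_m=\prod_{i\ge1}(1-q^{mi})$, and define the Appell–Lerch function $$m(x,q,z)=\frac{1}{j(z;q)}\sum_{r\in\mathbb{Z}}\frac{(-1)^rq^{\binom r2}z^r}{1-q^{r-1}xz}.$$ Let $x,y,z\in\mathbb{C}$ with $|q|<|x|<1$, $|q|<|y|<1$, $|q|<|z|<1$. Then the two triple series below converge absolutely, and if none of $xy$, $xz$, $yz$ equals $q$, $$\begin{aligned} \Big(\sum_{r,s,t\ge0}+\sum_{r,s,t<0}\Big)q^{rs+rt+st}x^ry^sz^t &=\frac{J_1^3\,j(yz;q)}{j(y;q)j(z;q)}\,m\Big(-\frac{qx}{yz},q^2,qyz\Big) +\frac{J_1^3\,j(xy;q)}{j(x;q)j(y;q)}\,m\Big(-\frac{qz}{xy},q^2,qxy\Big)\\ &\quad+\frac{J_1^3\,j(xz;q)}{j(x;q)j(z;q)}\,m\Big(-\frac{qy}{xz},q^2,qxz\Big)\\ &\quad-2\,\frac{J_1^3J_2^3}{j(x;q)j(y;q)j(z;q)}\cdot\frac{j(xy;q^2)j(xz;q^2)j(yz;q^2)}{j(-x;q^2)j(-y;q^2)j(-z;q^2)}.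 \end{aligned}$$ If one of $xy$, $xz$, $yz$ equals $q$, the right-hand side has a removable singularity at $(x,y,z)$ and the identity holds with the right-hand side replaced by its limit at $(x,y,z)$, taken over the points $(x',y',z')$ with $x'y',x'z',y'z'\ne q$. -/

import Mathlib

open Filter Topology

noncomputable section

namespace HeckeTriple

/-- The infinite `q`-Pochhammer symbol `(x; q)_∞ = ∏_{i ≥ 0} (1 - q^i x)`. -/
def qPoch (x q : ℂ) : ℂ := ∏' i : ℕ, (1 - q ^ i * x)

/-- The theta function `j(x; q) = (x; q)_∞ (q/x; q)_∞ (q; q)_∞`. -/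
def j (x q : ℂ) : ℂ := qPoch x q * qPoch (q / x) q * qPoch q q

/-- `J_m = ∏_{i ≥ 1} (1 - q^{m i}) = (q^m; q^m)_∞`. -/
def J (m : ℕ) (q : ℂ) : ℂ := qPoch (q ^ m) (q ^ m)

/-- The Appell–Lerch function
`m(x, q, z) = j(z; q)⁻¹ ∑_{r ∈ ℤ} (-1)^r q^{r(r-1)/2} z^r / (1 - q^{r-1} x z)`. -/
def m (x q z : ℂ) : ℂ :=
  1 / j z q *
    ∑' r : ℤ, (-1) ^ r * q ^ (r * (r - 1) / 2) * z ^ r / (1 - q ^ (r - 1) * x * z)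

/-- The summand `q^{rs+rt+st} x^r y^s z^t`, with `p = (r, s, t)`. -/
def term (q x y z : ℂ) (p : ℤ × ℤ × ℤ) : ℂ :=
  q ^ (p.1 * p.2.1 + p.1 * p.2.2 + p.2.1 * p.2.2) * x ^ p.1 * y ^ p.2.1 * z ^ p.2.2

/-- The triples `(r, s, t)` with `r, s, t ≥ 0`. -/
def nonnegTriples : Set (ℤ × ℤ × ℤ) := {p | 0 ≤ p.1 ∧ 0 ≤ p.2.1 ∧ 0 ≤ p.2.2}

/-- The triples `(r, s, t)` with `r, s, t < 0`. -/
def negTriples : Set (ℤ × ℤ × ℤ) := {p | p.1 < 0 ∧ p.2.1 < 0 ∧ p.2.2 < 0}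

/-- `(∑_{r,s,t ≥ 0} + ∑_{r,s,t < 0}) q^{rs+rt+st} x^r y^s z^t`. -/
def tripleSum (q x y z : ℂ) : ℂ :=
  (∑' p : nonnegTriples, term q x y z p) + ∑' p : negTriples, term q x y z p

/-- The expression of the triple sum through Appell–Lerch and theta functions. -/
def appellLerchSide (q x y z : ℂ) : ℂ :=
  J 1 q ^ 3 * j (y * z) q / (j y q * j z q) * m (-(q * x / (y * z))) (q ^ 2) (q * y * z)
  + J 1 q ^ 3 * j (x * y) q / (j x q * j y q) * m (-(q * z / (x * y))) (q ^ 2) (q * x * y)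
  - 2 * (J 1 q ^ 3 * J 2 q ^ 3 / (j x q * j y q * j z q))
    * (j (x * y) (q ^ 2) * j (x * z) (q ^ 2) * j (y * z) (q ^ 2)
      / (j (-x) (q ^ 2) * j (-y) (q ^ 2) * j (-z) (q ^ 2)))
  + J 1 q ^ 3 * j (x * z) q / (j x q * j z q) * m (-(q * y / (x * z))) (q ^ 2) (q * x * z)

/-- The points `(x, y, z)` with `xy, xz, yz ≠ q`. For `|q| < |x|, |y|, |z| < 1` these are exactly
the points at which every denominator in `appellLerchSide` is nonzero: `j(qyz; q²) = 0` only
for `yz = q`, and likewise for the other two pairs. -/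
def regularPoints (q : ℂ) : Set (ℂ × ℂ × ℂ) :=
  {p | p.1 * p.2.1 ≠ q ∧ p.1 * p.2.2 ≠ q ∧ p.2.1 * p.2.2 ≠ q}

end HeckeTriple

end

noncomputable section

namespace HeckeTriple

variable {q : ℂ}

/-- The open annulus `a < ‖z‖ < b` around the origin. -/
def annulus (a b : ℝ) : Set ℂ := {z | a < ‖z‖ ∧ ‖z‖ < b}

lemma isOpen_annulus (a b : ℝ) : IsOpen (annulus a b) :=
  (isOpen_lt continuous_const continuous_norm).inter (isOpen_lt continuous_norm continuous_const)

lemma circleIntegral_norm_mul (f : ℂ → ℂ) (p : ℂ) (r : ℝ) :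
    (∮ z in C(0, ‖p‖ * r), f z) = p * ∮ z in C(0, r), f (p * z) := by
  have hmap : ∀ θ : ℝ, circleMap 0 (‖p‖ * r) (θ + p.arg) = p * circleMap 0 r θ := by
    intro θ
    simp only [circleMap, zero_add]
    have h := Complex.norm_mul_exp_arg_mul_I p
    push_cast
    rw [add_mul, Complex.exp_add]
    conv_rhs => rw [← h]
    ring
  set h : ℝ → ℂ := fun θ ↦ deriv (circleMap 0 (‖p‖ * r)) θ • f (circleMap 0 (‖p‖ * r) θ) with hh
  have hper : Function.Periodic h (2 * Real.pi) := by
    intro θ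
    simp only [hh, deriv_circleMap, periodic_circleMap 0 (‖p‖ * r) θ]
  have key : ∫ θ in (0 : ℝ)..2 * Real.pi, h θ
      = ∫ θ in (0 : ℝ)..2 * Real.pi, h (θ + p.arg) := by
    rw [intervalIntegral.integral_comp_add_right, zero_add, add_comm (2 * Real.pi)]
    simpa using hper.intervalIntegral_add_eq 0 p.arg
  rw [circleIntegral, circleIntegral, key, ← intervalIntegral.integral_const_mul]
  congr 1
  ext θ
  simp only [hh, deriv_circleMap, hmap, smul_eq_mul]
  ring

/-- A continuous function on a circle with vanishing Laurent coefficients vanishes there. -/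
lemma eq_zero_of_circleIntegral_zpow_eq_zero {f : ℂ → ℂ} {r : ℝ} (hr : 0 < r)
    (hf : ContinuousOn f (Metric.sphere 0 r))
    (h : ∀ n : ℤ, (∮ z in C(0, r), z ^ (n - 1) * f z) = 0) {z : ℂ} (hz : ‖z‖ = r) : f z = 0 := by
  have : Fact (0 < 2 * Real.pi) := ⟨Real.two_pi_pos⟩
  have hmaps : ∀ t : AddCircle (2 * Real.pi), (r : ℂ) * (AddCircle.toCircle t : ℂ) ∈
      Metric.sphere (0 : ℂ) r := by
    intro t
    rw [mem_sphere_zero_iff_norm, norm_mul, Circle.norm_coe, mul_one, Complex.norm_real,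
      Real.norm_of_nonneg hr.le]
  let g : C(AddCircle (2 * Real.pi), ℂ) :=
    ⟨fun t ↦ f (r * (AddCircle.toCircle t : ℂ)), by
      refine hf.comp_continuous ?_ hmaps
      exact continuous_const.mul (continuous_subtype_val.comp AddCircle.continuous_toCircle)⟩
  have hcoe : ∀ x : ℝ, (r : ℂ) * (AddCircle.toCircle (x : AddCircle (2 * Real.pi)) : ℂ)
      = circleMap 0 r x := by
    intro x
    rw [AddCircle.toCircle_apply_mk]
    simp [circleMap, Circle.coe_exp, Real.pi_ne_zero]
  have hcoef : fourierCoeff g = 0 := by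
    funext n
    rw [fourierCoeff_eq_intervalIntegral _ n 0]
    have hn := h (-n)
    rw [circleIntegral] at hn
    have : ∀ x : ℝ, fourier (-n) (x : AddCircle (2 * Real.pi)) • g x =
        (Complex.I⁻¹ * (r : ℂ) ^ n) * (deriv (circleMap 0 r) x •
          ((circleMap 0 r x) ^ (-n - 1) * f (circleMap 0 r x))) := by
      intro x
      have hg : g (x : AddCircle (2 * Real.pi)) = f (circleMap 0 r x) := by
        simp only [g, ContinuousMap.coe_mk, hcoe]
      have hne : circleMap 0 r x ≠ 0 := circleMap_ne_center hr.ne'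
      have hr' : (r : ℂ) ≠ 0 := by exact_mod_cast hr.ne'
      rw [hg, fourier_coe_apply, deriv_circleMap, smul_eq_mul, smul_eq_mul, zpow_sub_one₀ hne]
      have h1 : Complex.exp (2 * Real.pi * Complex.I * ((-n : ℤ) : ℂ) * x / ((2 * Real.pi : ℝ) : ℂ))
          = (r : ℂ) ^ n * (circleMap 0 r x) ^ (-n) := by
        have h2 : circleMap 0 r x = r * Complex.exp (x * Complex.I) := by simp [circleMap]
        rw [h2, mul_zpow, ← mul_assoc, ← zpow_add₀ hr', add_neg_cancel, zpow_zero, one_mul,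
          ← Complex.exp_int_mul]
        congr 1
        have : (Real.pi : ℂ) ≠ 0 := by exact_mod_cast Real.pi_ne_zero
        push_cast
        field_simp
      rw [h1]
      field_simp
    simp_rw [this]
    rw [intervalIntegral.integral_const_mul, zero_add, hn]
    simp
  have hsum := hasSum_fourier_series_of_summable (f := g) (by rw [hcoef]; exact summable_zero)
  have hg0 : g = 0 := by
    refine hsum.unique ?_
    simp [hcoef, hasSum_zero]
  have hzr : circleMap 0 r z.arg = z := by
    rw [circleMap, ← hz, zero_add, Complex.norm_mul_exp_arg_mul_I]
  have : g (z.arg : AddCircle (2 * Real.pi)) = f z := by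
    simp only [g, ContinuousMap.coe_mk, hcoe, hzr]
  rw [← this, hg0]
  rfl

lemma circleIntegral_eq_of_differentiableOn_annulus {a b r s : ℝ} (ha : 0 ≤ a) {f : ℂ → ℂ}
    (hf : DifferentiableOn ℂ f (annulus a b)) (hr : a < r) (hr' : r < b) (hs : a < s)
    (hs' : s < b) : (∮ z in C(0, r), f z) = ∮ z in C(0, s), f z := by
  wlog hle : s ≤ r generalizing r s
  · exact (this hs hs' hr hr' (le_of_not_ge hle)).symm
  refine Complex.circleIntegral_eq_of_differentiable_on_annulus_off_countable (ha.trans_lt hs) hle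
    Set.countable_empty ?_ ?_
  · refine hf.continuousOn.mono fun z hz ↦ ?_
    simp only [Set.mem_sdiff, Metric.mem_closedBall, dist_zero_right, Metric.mem_ball, not_lt] at hz
    exact ⟨hs.trans_le hz.2, hz.1.trans_lt hr'⟩
  · intro z hz
    simp only [Set.mem_sdiff, Metric.mem_closedBall, dist_zero_right, Metric.mem_ball, not_le,
      Set.mem_empty_iff_false, not_false_eq_true, and_true] at hz
    exact hf.differentiableAt ((isOpen_annulus a b).mem_nhds
      ⟨hs.trans hz.2, hz.1.trans hr'⟩)

lemma differentiableOn_zpow_mul {a b : ℝ} (ha : 0 ≤ a) {f : ℂ → ℂ}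
    (hf : DifferentiableOn ℂ f (annulus a b)) (n : ℤ) :
    DifferentiableOn ℂ (fun z ↦ z ^ n * f z) (annulus a b) := by
  refine DifferentiableOn.mul (fun z hz ↦ ?_) hf
  have : z ≠ 0 := norm_pos_iff.mp (ha.trans_lt hz.1)
  exact (differentiableAt_zpow.mpr (Or.inl this)).differentiableWithinAt

/-- A holomorphic function on an annulus with `f (p z) = c z⁻¹ f z` on a circle and vanishing
constant Laurent coefficient is zero. -/
lemma eq_zero_of_quasiPeriodic {a b r : ℝ} (ha : 0 ≤ a) {p c : ℂ} (hp : p ≠ 0) (hp1 : ‖p‖ < 1)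
    (hc : c ≠ 0) {f : ℂ → ℂ} (hf : DifferentiableOn ℂ f (annulus a b))
    (har : a < ‖p‖ * r) (hrb : r < b) (hper : ∀ z : ℂ, ‖z‖ = r → f (p * z) = c * z⁻¹ * f z)
    (h0 : (∮ z in C(0, r), z⁻¹ * f z) = 0) {z : ℂ} (hz : z ∈ annulus a b) : f z = 0 := by
  have hp0 : 0 < ‖p‖ := norm_pos_iff.mpr hp
  have hr : 0 < r := by
    have := ha.trans_lt har
    exact pos_of_mul_pos_right this hp0.le
  have hpr : ‖p‖ * r < r := by nlinarith
  have har' : a < r := har.trans hpr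
  set A : ℤ → ℂ := fun n ↦ ∮ z in C(0, r), z ^ (n - 1) * f z with hA
  have hrec : ∀ n : ℤ, A n = p ^ n * c * A (n - 1) := by
    intro n
    have h1 : A n = ∮ z in C(0, ‖p‖ * r), z ^ (n - 1) * f z :=
      circleIntegral_eq_of_differentiableOn_annulus ha (differentiableOn_zpow_mul ha hf _) har' hrb
        har (hpr.trans hrb)
    rw [h1, circleIntegral_norm_mul, ← circleIntegral.integral_const_mul, hA]
    rw [← circleIntegral.integral_const_mul]
    refine circleIntegral.integral_congr hr.le fun w hw ↦ ?_
    have hw' : ‖w‖ = r := by simpa using hw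
    have hw0 : w ≠ 0 := norm_pos_iff.mp (hw' ▸ hr)
    rw [hper w hw', mul_zpow, zpow_sub_one₀ hp, zpow_sub_one₀ hw0 (n - 1)]
    field_simp
  have hA0 : A 0 = 0 := by
    rw [← h0, hA]
    simp
  have hall : ∀ n : ℤ, A n = 0 := by
    intro n
    induction n using Int.induction_on with
    | zero => exact hA0
    | succ k ih => rw [hrec, add_sub_cancel_right, ih, mul_zero]
    | pred k ih =>
      have := hrec (-k)
      rw [ih] at this
      exact (mul_eq_zero.mp this.symm).resolve_left (mul_ne_zero (zpow_ne_zero _ hp) hc)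
  refine eq_zero_of_circleIntegral_zpow_eq_zero (r := ‖z‖) (ha.trans_lt hz.1) ?_ ?_ rfl
  · refine hf.continuousOn.mono fun w hw ↦ ?_
    have hw' : ‖w‖ = ‖z‖ := by simpa using hw
    exact ⟨hw' ▸ hz.1, hw' ▸ hz.2⟩
  · intro n
    exact (circleIntegral_eq_of_differentiableOn_annulus ha (differentiableOn_zpow_mul ha hf _)
      hz.1 hz.2 har' hrb).trans (hall n)

/-- Two holomorphic functions on an annulus with the same quasi-period of degree `-1` are
proportional. -/
lemma mul_eq_mul_of_quasiPeriodic {a b r : ℝ} (ha : 0 ≤ a) {p c : ℂ} (hp : p ≠ 0)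
    (hp1 : ‖p‖ < 1) (hc : c ≠ 0) {f g : ℂ → ℂ} (hf : DifferentiableOn ℂ f (annulus a b))
    (hg : DifferentiableOn ℂ g (annulus a b)) (har : a < ‖p‖ * r) (hrb : r < b)
    (hfper : ∀ z : ℂ, ‖z‖ = r → f (p * z) = c * z⁻¹ * f z)
    (hgper : ∀ z : ℂ, ‖z‖ = r → g (p * z) = c * z⁻¹ * g z)
    {z w : ℂ} (hz : z ∈ annulus a b) (hw : w ∈ annulus a b) : f z * g w = f w * g z := by
  set A := ∮ z in C(0, r), z⁻¹ * f z with hA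
  set C := ∮ z in C(0, r), z⁻¹ * g z with hC
  have hp0 : 0 < ‖p‖ := norm_pos_iff.mpr hp
  have hr : 0 < r := pos_of_mul_pos_right (ha.trans_lt har) hp0.le
  have har' : a < r := har.trans (by nlinarith)
  have hint : ∀ h : ℂ → ℂ, DifferentiableOn ℂ h (annulus a b) →
      CircleIntegrable (fun z ↦ z⁻¹ * h z) 0 r := by
    intro h hh
    refine ContinuousOn.circleIntegrable hr.le ?_
    have := (differentiableOn_zpow_mul ha hh (-1)).continuousOn
    simp only [zpow_neg_one] at this
    refine this.mono fun w hw ↦ ?_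
    have hw' : ‖w‖ = r := by simpa using hw
    exact ⟨hw' ▸ har', hw' ▸ hrb⟩
  have key : ∀ u ∈ annulus a b, C * f u - A * g u = 0 := by
    intro u hu
    refine eq_zero_of_quasiPeriodic (f := fun u ↦ C * f u - A * g u) ha hp hp1 hc
      ((hf.const_mul C).sub (hg.const_mul A)) har hrb ?_ ?_ hu
    · intro z hz
      simp only [hfper z hz, hgper z hz]
      ring
    · have : ∀ z : ℂ, z⁻¹ * (C * f z - A * g z) = C * (z⁻¹ * f z) - A * (z⁻¹ * g z) := by
        intro z; ring
      simp_rw [this]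
      rw [circleIntegral.integral_sub, circleIntegral.integral_const_mul,
        circleIntegral.integral_const_mul, ← hA, ← hC]
      · ring
      · exact (hint f hf).const_fun_smul (a := C)
      · exact (hint g hg).const_fun_smul (a := A)
  by_cases hA0 : A = 0
  · have hf0 : ∀ u ∈ annulus a b, f u = 0 := fun u hu ↦
      eq_zero_of_quasiPeriodic ha hp hp1 hc hf har hrb hfper hA0 hu
    rw [hf0 z hz, hf0 w hw, zero_mul, zero_mul]
  · have h1 := key z hz
    have h2 := key w hw
    have : A * (f z * g w - f w * g z) = 0 := by linear_combination f w * h1 - f z * h2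
    exact sub_eq_zero.mp ((mul_eq_zero.mp this).resolve_left hA0)

lemma summable_qPoch (hq : ‖q‖ < 1) (x : ℂ) : Summable fun i : ℕ ↦ ‖-(q ^ i * x)‖ := by
  simp only [norm_neg, norm_mul, norm_pow]
  exact (summable_geometric_of_lt_one (norm_nonneg q) hq).mul_right _

lemma multipliable_qPoch (hq : ‖q‖ < 1) (x : ℂ) :
    Multipliable fun i : ℕ ↦ (1 - q ^ i * x) := by
  simpa [sub_eq_add_neg] using multipliable_one_add_of_summable (summable_qPoch hq x)

lemma tendsto_prod_qPoch (hq : ‖q‖ < 1) (x : ℂ) :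
    Tendsto (fun n ↦ ∏ i ∈ Finset.range n, (1 - q ^ i * x)) atTop (𝓝 (qPoch x q)) :=
  (multipliable_qPoch hq x).hasProd.tendsto_prod_nat

lemma qPoch_eq_mul (hq : ‖q‖ < 1) (x : ℂ) : qPoch x q = (1 - x) * qPoch (q * x) q := by
  refine tendsto_nhds_unique ((tendsto_prod_qPoch hq x).comp (tendsto_add_atTop_nat 1))
    (((tendsto_prod_qPoch hq (q * x)).const_mul (1 - x)).congr fun n ↦ ?_)
  rw [Function.comp, Finset.prod_range_succ', mul_comm]
  simp [pow_succ, mul_assoc]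

lemma qPoch_ne_zero (hq : ‖q‖ < 1) {x : ℂ} (hx : ∀ i : ℕ, q ^ i * x ≠ 1) : qPoch x q ≠ 0 := by
  have := tprod_one_add_ne_zero_of_summable (f := fun i : ℕ ↦ -(q ^ i * x))
    (fun i h ↦ hx i (by linear_combination -h)) (summable_qPoch hq x)
  simpa [qPoch, sub_eq_add_neg] using this

lemma qPoch_ne_zero_of_norm_lt (hq : ‖q‖ < 1) {x : ℂ} (hx : ‖x‖ < 1) : qPoch x q ≠ 0 := by
  refine qPoch_ne_zero hq fun i h ↦ ?_
  have h1 : ‖q ^ i * x‖ = 1 := by rw [h, norm_one]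
  rw [norm_mul, norm_pow] at h1
  have h2 : ‖q‖ ^ i ≤ 1 := pow_le_one₀ (norm_nonneg _) hq.le
  nlinarith [norm_nonneg x, pow_nonneg (norm_nonneg q) i]

lemma qPoch_one (hq : ‖q‖ < 1) : qPoch 1 q = 0 := by
  rw [qPoch_eq_mul hq]; simp

lemma differentiable_qPoch (hq : ‖q‖ < 1) : Differentiable ℂ fun x ↦ qPoch x q := by
  intro x
  have hK : IsOpen (Metric.ball (0 : ℂ) (‖x‖ + 1)) := Metric.isOpen_ball
  have h : HasProdLocallyUniformlyOn (fun (i : ℕ) (y : ℂ) ↦ 1 + -(q ^ i * y))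
      (fun y ↦ ∏' i : ℕ, (1 + -(q ^ i * y))) (Metric.ball 0 (‖x‖ + 1)) := by
    refine Summable.hasProdLocallyUniformlyOn_nat_one_add (u := fun i ↦ ‖q‖ ^ i * (‖x‖ + 1)) hK
      ((summable_geometric_of_lt_one (norm_nonneg q) hq).mul_right _) ?_ ?_
    · refine Eventually.of_forall fun i y hy ↦ ?_
      rw [norm_neg, norm_mul, norm_pow]
      have : ‖y‖ < ‖x‖ + 1 := by simpa using hy
      gcongr
    · intro i
      fun_prop
  have hd := h.differentiableOn (Eventually.of_forall fun s ↦ by fun_prop) hK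
  have hx : x ∈ Metric.ball (0 : ℂ) (‖x‖ + 1) := by simp
  have := hd.differentiableAt (hK.mem_nhds hx)
  simpa [qPoch, sub_eq_add_neg] using this

lemma norm_pow_lt_one (hq : ‖q‖ < 1) {k : ℕ} (hk : k ≠ 0) : ‖q ^ k‖ < 1 := by
  rw [norm_pow]; exact pow_lt_one₀ (norm_nonneg _) hq hk

lemma qPoch_eq_mul_sq (hq : ‖q‖ < 1) (x : ℂ) :
    qPoch x q = qPoch x (q ^ 2) * qPoch (q * x) (q ^ 2) := by
  have hq2 := norm_pow_lt_one hq two_ne_zero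
  have h1 := (tendsto_prod_qPoch hq x).comp
    (tendsto_id.const_mul_atTop' (r := 2) two_pos)
  have h2 := (tendsto_prod_qPoch hq2 x).mul (tendsto_prod_qPoch hq2 (q * x))
  refine tendsto_nhds_unique h1 (h2.congr fun n ↦ ?_)
  simp only [Function.comp, id]
  induction n with
  | zero => simp
  | succ n ih =>
    rw [show 2 * (n + 1) = 2 * n + 1 + 1 by ring, Finset.prod_range_succ, Finset.prod_range_succ,
      Finset.prod_range_succ, Finset.prod_range_succ, ← ih]
    ring

lemma qPoch_eq_mul_cube (hq : ‖q‖ < 1) (x : ℂ) :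
    qPoch x q = qPoch x (q ^ 3) * qPoch (q * x) (q ^ 3) * qPoch (q ^ 2 * x) (q ^ 3) := by
  have hq3 := norm_pow_lt_one hq three_ne_zero
  have h1 := (tendsto_prod_qPoch hq x).comp
    (tendsto_id.const_mul_atTop' (r := 3) three_pos)
  have h2 := ((tendsto_prod_qPoch hq3 x).mul (tendsto_prod_qPoch hq3 (q * x))).mul
    (tendsto_prod_qPoch hq3 (q ^ 2 * x))
  refine tendsto_nhds_unique h1 (h2.congr fun n ↦ ?_)
  simp only [Function.comp, id]
  induction n with
  | zero => simp
  | succ n ih =>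
    rw [show 3 * (n + 1) = 3 * n + 1 + 1 + 1 by ring, Finset.prod_range_succ,
      Finset.prod_range_succ, Finset.prod_range_succ, Finset.prod_range_succ, Finset.prod_range_succ, Finset.prod_range_succ, ← ih]
    ring

lemma qPoch_neg_mul_qPoch (hq : ‖q‖ < 1) (x : ℂ) :
    qPoch (-x) q * qPoch x q = qPoch (x ^ 2) (q ^ 2) := by
  rw [qPoch, qPoch, qPoch, ← (multipliable_qPoch hq (-x)).tprod_mul (multipliable_qPoch hq x)]
  congr 1
  ext i
  ring

/-- The theta function with the factor `1 - x` removed. -/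
def jReg (x q : ℂ) : ℂ := qPoch (q * x) q * qPoch (q / x) q * qPoch q q

lemma j_eq_mul_jReg (hq : ‖q‖ < 1) (x : ℂ) : j x q = (1 - x) * jReg x q := by
  rw [j, jReg, qPoch_eq_mul hq x]; ring

lemma jReg_one : jReg 1 q = qPoch q q ^ 3 := by
  simp only [jReg, mul_one, div_one]; ring

lemma j_one (hq : ‖q‖ < 1) : j 1 q = 0 := by
  rw [j_eq_mul_jReg hq]; simp

lemma j_self (hq : ‖q‖ < 1) (hq0 : q ≠ 0) : j q q = 0 := by
  rw [j, div_self hq0, qPoch_one hq]; simp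

lemma j_mul (hq : ‖q‖ < 1) (hq0 : q ≠ 0) {x : ℂ} (hx : x ≠ 0) :
    j (q * x) q = -x⁻¹ * j x q := by
  have h1 : q / (q * x) = x⁻¹ := by field_simp
  have h2 : qPoch x⁻¹ q = (1 - x⁻¹) * qPoch (q / x) q := by
    rw [qPoch_eq_mul hq, div_eq_mul_inv]
  rw [j, j, h1, h2, qPoch_eq_mul hq x]
  field_simp
  ring

lemma j_sq_mul (hq : ‖q‖ < 1) (hq0 : q ≠ 0) {x : ℂ} (hx : x ≠ 0) :
    j (q ^ 2 * x) q = q⁻¹ * (x ^ 2)⁻¹ * j x q := by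
  rw [pow_two, mul_assoc, j_mul hq hq0 (mul_ne_zero hq0 hx), j_mul hq hq0 hx]
  field_simp

lemma differentiableAt_j (hq : ‖q‖ < 1) {x : ℂ} (hx : x ≠ 0) :
    DifferentiableAt ℂ (fun x ↦ j x q) x := by
  have h1 := differentiable_qPoch hq x
  have h2 : DifferentiableAt ℂ (fun x ↦ qPoch (q / x) q) x :=
    (differentiable_qPoch hq (q / x)).comp x (f := fun x ↦ q / x)
      ((differentiableAt_const q).div differentiableAt_id hx)
  exact (h1.mul h2).mul_const _

lemma differentiableAt_jReg (hq : ‖q‖ < 1) {x : ℂ} (hx : x ≠ 0) :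
    DifferentiableAt ℂ (fun x ↦ jReg x q) x := by
  have h1 : DifferentiableAt ℂ (fun x ↦ qPoch (q * x) q) x :=
    (differentiable_qPoch hq (q * x)).comp x (f := fun x ↦ q * x) (by fun_prop)
  have h2 : DifferentiableAt ℂ (fun x ↦ qPoch (q / x) q) x :=
    (differentiable_qPoch hq (q / x)).comp x (f := fun x ↦ q / x)
      ((differentiableAt_const q).div differentiableAt_id hx)
  exact (h1.mul h2).mul_const _

lemma differentiableAt_j_comp (hq : ‖q‖ < 1) {f : ℂ → ℂ} {x : ℂ} (hf : DifferentiableAt ℂ f x)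
    (hx : f x ≠ 0) : DifferentiableAt ℂ (fun x ↦ j (f x) q) x :=
  (differentiableAt_j hq hx).comp x hf

/-- `j(x;q)` does not vanish on `‖q‖ < ‖x‖ < 1`. -/
lemma j_ne_zero (hq : ‖q‖ < 1) {x : ℂ} (h1 : ‖q‖ < ‖x‖) (h2 : ‖x‖ < 1) : j x q ≠ 0 := by
  have hx : 0 < ‖x‖ := (norm_nonneg q).trans_lt h1
  refine mul_ne_zero (mul_ne_zero (qPoch_ne_zero_of_norm_lt hq h2)
    (qPoch_ne_zero_of_norm_lt hq ?_)) (qPoch_ne_zero_of_norm_lt hq hq)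
  rwa [norm_div, div_lt_one hx]

lemma j_eq_mul_sq (hq : ‖q‖ < 1) (hq0 : q ≠ 0) (x : ℂ) :
    j x q * J 2 q ^ 2 = j x (q ^ 2) * j (q * x) (q ^ 2) * J 1 q := by
  have h1 : q * (q / x) = q ^ 2 / x := by ring
  have h2 : q ^ 2 / (q * x) = q / x := by rw [pow_two, mul_div_mul_left _ _ hq0]
  simp only [j, J, pow_one]
  rw [h2, qPoch_eq_mul_sq hq x, qPoch_eq_mul_sq hq (q / x), h1]
  ring

lemma J_ne_zero (hq : ‖q‖ < 1) {k : ℕ} (hk : k ≠ 0) : J k q ≠ 0 :=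
  qPoch_ne_zero_of_norm_lt (norm_pow_lt_one hq hk) (norm_pow_lt_one hq hk)

lemma j_neg_one (hq : ‖q‖ < 1) : j (-1) q * J 1 q = 2 * J 2 q ^ 2 := by
  have h := qPoch_neg_mul_qPoch hq q
  have h1 : qPoch (-1) q = 2 * qPoch (-q) q := by
    rw [qPoch_eq_mul hq]; norm_num
  simp only [j, J, pow_one, ← h, h1, div_neg, div_one]
  ring

lemma summable_pow_sq_mul_pow {t ρ : ℝ} (ht0 : 0 ≤ t) (ht : t < 1) (hρ : 0 ≤ ρ) :
    Summable fun n : ℕ ↦ t ^ (n ^ 2) * ρ ^ n := by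
  have h1 : Tendsto (fun n : ℕ ↦ t ^ n * ρ) atTop (𝓝 0) := by
    simpa using (tendsto_pow_atTop_nhds_zero_of_lt_one ht0 ht).mul_const ρ
  have h2 : ∀ᶠ n : ℕ in atTop, t ^ n * ρ ≤ 1 / 2 := h1.eventually_le_const (by norm_num)
  refine Summable.of_norm_bounded_eventually_nat
    (summable_geometric_of_lt_one (r := 1 / 2) (by norm_num) (by norm_num)) ?_
  filter_upwards [h2] with n hn
  rw [pow_two, pow_mul, ← mul_pow, Real.norm_of_nonneg (by positivity)]
  gcongr

lemma summable_zpow_sq_mul_zpow {t ρ : ℝ} (ht0 : 0 ≤ t) (ht : t < 1) (hρ : 0 ≤ ρ) :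
    Summable fun r : ℤ ↦ t ^ (r ^ 2) * ρ ^ r := by
  refine Summable.of_nat_of_neg ?_ ?_
  · exact_mod_cast summable_pow_sq_mul_pow ht0 ht hρ
  · have := summable_pow_sq_mul_pow ht0 ht (inv_nonneg.mpr hρ)
    refine this.congr fun n ↦ ?_
    rw [neg_sq, zpow_neg, inv_pow]
    norm_cast

/-- The terms of the theta series `∑ (-1)^r q^{r²} w^r`. -/
def thetaTerm (q w : ℂ) (r : ℤ) : ℂ := (-1) ^ r * q ^ (r ^ 2) * w ^ r

/-- The theta series `∑_{r ∈ ℤ} (-1)^r q^{r²} w^r`. -/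
def theta (q w : ℂ) : ℂ := ∑' r : ℤ, thetaTerm q w r

/-- The Appell sum `∑_{r ∈ ℤ} (-1)^r q^{r²} w^r / (1 + q^{2r} x)`. -/
def appell (q x w : ℂ) : ℂ := ∑' r : ℤ, thetaTerm q w r / (1 + q ^ (2 * r) * x)

/-- The Appell sum without its term at `r = 0`. -/
def appellReg (q x w : ℂ) : ℂ :=
  ∑' r : ℤ, if r = 0 then 0 else thetaTerm q w r / (1 + q ^ (2 * r) * x)

lemma norm_thetaTerm (q w : ℂ) (r : ℤ) : ‖thetaTerm q w r‖ = ‖q‖ ^ (r ^ 2) * ‖w‖ ^ r := by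
  simp [thetaTerm]

lemma summable_norm_thetaTerm (hq : ‖q‖ < 1) (w : ℂ) : Summable fun r ↦ ‖thetaTerm q w r‖ := by
  simp only [norm_thetaTerm]
  exact summable_zpow_sq_mul_zpow (norm_nonneg q) hq (norm_nonneg w)

lemma zpow_le_zpow_add_zpow {a t b : ℝ} (ha : 0 < a) (hat : a ≤ t) (htb : t ≤ b) (r : ℤ) :
    t ^ r ≤ b ^ r + a ^ r := by
  have ht : 0 < t := ha.trans_le hat
  have hb : 0 < b := ht.trans_le htb
  rcases le_total 0 r with hr | hr
  · have := zpow_le_zpow_left₀ hr ht.le htb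
    have := zpow_pos ha r
    linarith
  · have : t ^ r ≤ a ^ r := by
      obtain ⟨n, rfl⟩ := Int.eq_ofNat_of_zero_le (neg_nonneg.mpr hr) |>.imp fun n hn ↦
        (neg_eq_iff_eq_neg.mp hn)
      rw [zpow_neg, zpow_neg, zpow_natCast, zpow_natCast]
      gcongr
    have := zpow_pos hb r
    linarith

/-- Differentiability of theta-like series with bounded coefficients. -/
lemma differentiableAt_tsum_thetaTerm_mul (hq : ‖q‖ < 1) {a : ℤ → ℂ} {C : ℝ}
    (ha : ∀ r, ‖a r‖ ≤ C) {w : ℂ} (hw : w ≠ 0) :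
    DifferentiableAt ℂ (fun w ↦ ∑' r : ℤ, thetaTerm q w r * a r) w := by
  have hC : 0 ≤ C := (norm_nonneg _).trans (ha 0)
  have hw' : 0 < ‖w‖ := norm_pos_iff.mpr hw
  set U := annulus (‖w‖ / 2) (‖w‖ + 1)
  have hU : IsOpen U := isOpen_annulus _ _
  have hd : DifferentiableOn ℂ (fun w ↦ ∑' r : ℤ, thetaTerm q w r * a r) U := by
    refine Complex.differentiableOn_tsum_of_summable_norm
      (u := fun r ↦ (‖q‖ ^ (r ^ 2) * (‖w‖ + 1) ^ r + ‖q‖ ^ (r ^ 2) * (‖w‖ / 2) ^ r) * C)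
      (((summable_zpow_sq_mul_zpow (norm_nonneg q) hq (by positivity)).add
        (summable_zpow_sq_mul_zpow (norm_nonneg q) hq (by positivity))).mul_right C) ?_ hU ?_
    · intro r z hz
      have hz0 : z ≠ 0 := norm_pos_iff.mp (lt_trans (by positivity) hz.1)
      exact (((differentiableAt_zpow.mpr (Or.inl hz0)).const_mul _).mul_const
        _).differentiableWithinAt
    · intro r z hz
      rw [norm_mul, norm_thetaTerm, ← mul_add]
      have := zpow_le_zpow_add_zpow (by positivity) hz.1.le hz.2.le r
      have := ha r
      have : 0 ≤ ‖q‖ ^ (r ^ 2) := by positivity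
      gcongr
  exact hd.differentiableAt (hU.mem_nhds ⟨by linarith, by linarith⟩)

lemma differentiableAt_theta (hq : ‖q‖ < 1) {w : ℂ} (hw : w ≠ 0) :
    DifferentiableAt ℂ (fun w ↦ theta q w) w := by
  simpa [theta] using differentiableAt_tsum_thetaTerm_mul hq (a := fun _ ↦ 1) (C := 1) (by simp) hw

lemma thetaTerm_add_one (hq0 : q ≠ 0) {w : ℂ} (hw : w ≠ 0) (r : ℤ) :
    thetaTerm q w (r + 1) = -(q * w) * (q ^ (2 * r) * thetaTerm q w r) := by
  have h : (r + 1) ^ 2 = r ^ 2 + 2 * r + 1 := by ring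
  simp only [thetaTerm]
  rw [h, zpow_add_one₀ hq0, zpow_add₀ hq0, zpow_add_one₀ hw, zpow_add_one₀ (by norm_num)]
  ring

lemma thetaTerm_sq_mul (q w : ℂ) (r : ℤ) :
    thetaTerm q (q ^ 2 * w) r = q ^ (2 * r) * thetaTerm q w r := by
  simp only [thetaTerm]
  rw [mul_zpow, zpow_mul]
  norm_cast
  ring

lemma theta_sq_mul (hq0 : q ≠ 0) {w : ℂ} (hw : w ≠ 0) :
    theta q (q ^ 2 * w) = -(q * w)⁻¹ * theta q w := by
  have h : theta q w = -(q * w) * theta q (q ^ 2 * w) := by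
    rw [theta, theta, ← (Equiv.addRight (1 : ℤ)).tsum_eq, ← tsum_mul_left]
    congr 1
    ext r
    rw [Equiv.coe_addRight, thetaTerm_add_one hq0 hw, thetaTerm_sq_mul]
  rw [h]
  field_simp

lemma exists_norm_pow_mul_prod_le {c : ℂ} (hc : ‖c‖ < 1) :
    ∃ M : ℝ, 0 ≤ M ∧ ∀ k n : ℕ, ‖c ^ ((k + 1) * n) *
      ∏ i ∈ Finset.range (n + 1), (1 - c ^ (k + i + 1))‖ ≤ M * ‖c‖ ^ n := by
  refine ⟨Real.exp (1 - ‖c‖)⁻¹, (Real.exp_pos _).le, fun k n ↦ ?_⟩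
  have hs := summable_geometric_of_lt_one (norm_nonneg c) hc
  have h1 : ‖∏ i ∈ Finset.range (n + 1), (1 - c ^ (k + i + 1))‖ ≤ Real.exp (1 - ‖c‖)⁻¹ := by
    have h2 := Finset.norm_prod_one_add_sub_one_le (Finset.range (n + 1))
      (fun i ↦ -c ^ (k + i + 1))
    have h3 : ∑ i ∈ Finset.range (n + 1), ‖-c ^ (k + i + 1)‖ ≤ (1 - ‖c‖)⁻¹ := by
      rw [← tsum_geometric_of_lt_one (norm_nonneg c) hc]
      refine le_trans (Finset.sum_le_sum fun i _ ↦ ?_) (hs.sum_le_tsum (Finset.range (n + 1))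
        fun i _ ↦ by positivity)
      rw [norm_neg, norm_pow]
      exact pow_le_pow_of_le_one (norm_nonneg _) hc.le (by omega)
    have h4 := Real.exp_le_exp.mpr h3
    have h5 := norm_le_norm_add_norm_sub' (∏ i ∈ Finset.range (n + 1), (1 + -c ^ (k + i + 1))) 1
    simp only [← sub_eq_add_neg, norm_one] at h2 h5
    linarith
  rw [norm_mul, norm_pow, mul_comm (Real.exp _)]
  gcongr ?_ * ?_
  exact pow_le_pow_of_le_one (norm_nonneg _) hc.le (by nlinarith)

/-- The pentagonal number theorem as a sum over the integers. -/
lemma qPoch_self_eq_tsum {c : ℂ} (hc : ‖c‖ < 1)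
    (hs : Summable fun r : ℤ ↦ (-1) ^ r * c ^ pentagonal r) :
    qPoch c c = ∑' r : ℤ, (-1) ^ r * c ^ pentagonal r := by
  obtain ⟨M, hM0, hM⟩ := exists_norm_pow_mul_prod_le hc
  have hgeo := summable_geometric_of_lt_one (norm_nonneg c) hc
  set f : ℤ → ℂ := fun r ↦ (-1) ^ r * c ^ pentagonal r with hf
  have hf' : Summable fun r : ℤ ↦ f (-r) := hs.comp_injective neg_injective
  have hp1 : Summable fun n : ℕ ↦ f (-n) := hf'.comp_injective Nat.cast_injective
  have hp2 : Summable fun n : ℕ ↦ f (-(-(n + 1))) :=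
    hf'.comp_injective (i := fun n : ℕ ↦ (-((n : ℤ) + 1))) (fun a b h ↦ by simpa using h)
  have hterm : ∀ k : ℕ, (-1) ^ k * (c ^ pentagonal (-k) - c ^ pentagonal (k + 1))
      = f (-k) + f (-(-(k + 1))) := by
    intro k
    simp only [hf, neg_neg]
    rw [zpow_add_one₀ (by norm_num), zpow_neg, zpow_natCast]
    have : ((-1 : ℂ) ^ k)⁻¹ = (-1) ^ k := by
      rw [← inv_pow]; norm_num
    rw [this]
    ring
  have h := Pentagonal.tprod_one_sub_pow (x := c)
    (tendsto_pow_atTop_nhds_zero_of_norm_lt_one hc)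
    (fun k ↦ Summable.of_norm_bounded (hgeo.mul_left M) (hM k))
    (fun k ↦ by
      refine (multipliable_qPoch hc (c ^ (k + 1))).congr fun n ↦ ?_
      rw [← pow_add, add_assoc])
    ((hp1.add hp2).congr fun k ↦ (hterm k).symm)
    (by
      have hc1 : Tendsto (fun k : ℕ ↦ ‖c‖ ^ k * ∑' n : ℕ, M * ‖c‖ ^ n) atTop (𝓝 0) := by
        simpa using (tendsto_pow_atTop_nhds_zero_of_lt_one (norm_nonneg c) hc).mul_const
          (∑' n : ℕ, M * ‖c‖ ^ n)
      refine squeeze_zero_norm (fun k ↦ ?_) hc1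
      rw [norm_mul, norm_mul, norm_pow, norm_neg, norm_one, one_pow, one_mul, norm_pow]
      gcongr ?_ * ?_
      · refine pow_le_pow_of_le_one (norm_nonneg _) hc.le ?_
        rw [Nat.le_div_iff_mul_le two_pos]
        nlinarith
      · exact tsum_of_norm_bounded (hgeo.mul_left M).hasSum (hM k))
  have hq : qPoch c c = ∏' n : ℕ, (1 - c ^ (n + 1)) := by
    simp only [qPoch, pow_succ]
  rw [hq, h, tsum_congr hterm, hp1.tsum_add hp2, ← (Equiv.neg ℤ).tsum_eq]
  exact (tsum_of_nat_of_neg_add_one (f := fun r ↦ f (-r)) hp1 hp2).symm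

/-- The Jacobi triple product identity. -/
lemma theta_eq_j (hq : ‖q‖ < 1) (hq0 : q ≠ 0) {w : ℂ} (hw : w ≠ 0) :
    theta q w = j (q * w) (q ^ 2) := by
  have hq2 := norm_pow_lt_one hq two_ne_zero
  have hq20 : q ^ 2 ≠ 0 := pow_ne_zero 2 hq0
  obtain ⟨c, hc3⟩ := IsAlgClosed.exists_pow_nat_eq (q ^ 2) (n := 3) (by norm_num)
  have hc0 : c ≠ 0 := by rintro rfl; exact hq20 (by rw [← hc3]; simp)
  have hc : ‖c‖ < 1 := by
    by_contra h
    push Not at h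
    have : (1 : ℝ) ≤ ‖c ^ 3‖ := by rw [norm_pow]; exact one_le_pow₀ h
    rw [hc3] at this
    linarith
  have hterm : ∀ r : ℤ, thetaTerm q (c / q) r = (-1) ^ r * c ^ pentagonal r := by
    intro r
    obtain ⟨k, hk⟩ := (Int.even_mul_pred_self r)
    have h1 : r ^ 2 = 2 * k + r := by linarith
    have h2 : (pentagonal r : ℤ) = 3 * k + r := by
      have := two_mul_natCast_pentagonal r
      linarith
    rw [thetaTerm, h1, ← zpow_natCast c, h2, zpow_add₀ hq0, zpow_add₀ hc0, div_zpow, zpow_mul,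
      zpow_mul, mul_assoc]
    have h3 : (c ^ (3 : ℤ)) = q ^ (2 : ℤ) := by exact_mod_cast hc3
    rw [h3]
    have := zpow_ne_zero r hq0
    field_simp
  have hw0 : c / q ≠ 0 := div_ne_zero hc0 hq0
  have hval : theta q (c / q) = qPoch c c := by
    rw [qPoch_self_eq_tsum hc, theta, tsum_congr hterm]
    exact (summable_norm_thetaTerm hq (c / q)).of_norm.congr hterm
  have hval' : j (q * (c / q)) (q ^ 2) = qPoch c c := by
    rw [mul_div_cancel₀ _ hq0, ← hc3, j, qPoch_eq_mul_cube hc c]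
    have h1 : c ^ 3 / c = c * c := by field_simp
    rw [h1, ← pow_succ]
  have hne := qPoch_ne_zero_of_norm_lt hc hc
  set b := ‖w‖ + ‖c / q‖ + 1 with hb
  have hpos : ∀ z ∈ annulus 0 b, z ≠ 0 := fun z hz ↦ norm_pos_iff.mp hz.1
  have hcross := mul_eq_mul_of_quasiPeriodic (a := 0) (b := b) (r := 1 / 2) le_rfl hq20 hq2
    (c := -q⁻¹) (neg_ne_zero.mpr (inv_ne_zero hq0)) (f := fun w ↦ theta q w)
    (g := fun w ↦ j (q * w) (q ^ 2))
    (fun z hz ↦ (differentiableAt_theta hq (hpos z hz)).differentiableWithinAt)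
    (fun z hz ↦ (differentiableAt_j_comp hq2 (f := fun z ↦ q * z) (by fun_prop)
      (mul_ne_zero hq0 (hpos z hz))).differentiableWithinAt)
    (by have := norm_pos_iff.mpr hq20; positivity)
    (by rw [hb]; have := norm_nonneg w; have := norm_nonneg (c / q); linarith)
    (fun z hz ↦ by
      have hz0 : z ≠ 0 := norm_pos_iff.mp (by rw [hz]; norm_num)
      rw [theta_sq_mul hq0 hz0, mul_inv]; ring)
    (fun z hz ↦ by
      have hz0 : z ≠ 0 := norm_pos_iff.mp (by rw [hz]; norm_num)
      rw [show q * (q ^ 2 * z) = q ^ 2 * (q * z) by ring, j_mul hq2 hq20 (mul_ne_zero hq0 hz0),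
        mul_inv]
      ring)
    (z := w) (w := c / q)
    ⟨norm_pos_iff.mpr hw, by rw [hb]; have := norm_nonneg (c / q); linarith⟩
    ⟨norm_pos_iff.mpr hw0, by rw [hb]; have := norm_nonneg w; linarith⟩
  simp only [hval, hval'] at hcross
  rw [mul_comm] at hcross
  exact mul_left_cancel₀ hne hcross

/-- A uniform lower bound for the denominators of the Appell sum. -/
lemma exists_le_norm_one_add (hq : ‖q‖ < 1) (hq0 : q ≠ 0) {a b : ℝ} (ha : ‖q‖ ^ 2 < a)
    (hb : ‖q‖ ^ 2 * b < 1) :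
    ∃ δ : ℝ, 0 < δ ∧ ∀ x ∈ annulus a b, ∀ r : ℤ, r ≠ 0 → δ ≤ ‖1 + q ^ (2 * r) * x‖ := by
  have hq' : 0 < ‖q‖ := norm_pos_iff.mpr hq0
  have ha' : 1 < a / ‖q‖ ^ 2 := by rwa [one_lt_div (by positivity)]
  refine ⟨min (1 - ‖q‖ ^ 2 * b) (a / ‖q‖ ^ 2 - 1), lt_min (by linarith) (by linarith), ?_⟩
  intro x hx r hr
  have hnorm : ‖q ^ (2 * r) * x‖ = (‖q‖ ^ 2) ^ r * ‖x‖ := by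
    rw [norm_mul, norm_zpow, zpow_mul]; norm_cast
  have ht1 : ‖q‖ ^ 2 < 1 := pow_lt_one₀ (norm_nonneg _) hq two_ne_zero
  rcases lt_or_gt_of_ne hr with h | h
  · refine (min_le_right _ _).trans ?_
    have h1 : (‖q‖ ^ 2)⁻¹ ≤ (‖q‖ ^ 2) ^ r := by
      rw [← zpow_neg_one]
      exact zpow_le_zpow_right_of_le_one₀ (by positivity) ht1.le (by omega)
    have h2 := norm_sub_norm_le (q ^ (2 * r) * x) (-1)
    rw [sub_neg_eq_add, norm_neg, norm_one, hnorm, add_comm _ (1 : ℂ)] at h2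
    have h3 : a / ‖q‖ ^ 2 ≤ (‖q‖ ^ 2) ^ r * ‖x‖ := by
      rw [div_eq_mul_inv, mul_comm]
      have := hx.1.le
      have : 0 ≤ a := by linarith [sq_nonneg ‖q‖]
      gcongr
    linarith
  · refine (min_le_left _ _).trans ?_
    have h1 : (‖q‖ ^ 2) ^ r ≤ ‖q‖ ^ 2 := by
      conv_rhs => rw [← zpow_one (‖q‖ ^ 2)]
      exact zpow_le_zpow_right_of_le_one₀ (by positivity) ht1.le (by omega)
    have h2 := norm_sub_norm_le (1 : ℂ) (-(q ^ (2 * r) * x))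
    rw [sub_neg_eq_add, norm_neg, norm_one, hnorm] at h2
    have h3 : (‖q‖ ^ 2) ^ r * ‖x‖ ≤ ‖q‖ ^ 2 * b := by
      have := hx.2.le
      gcongr
    linarith

/-- Points of the annulus `‖q‖² < ‖x‖ < ‖q‖⁻²`. -/
lemma exists_annulus_mem (hq0 : q ≠ 0) {x : ℂ} (h1 : ‖q‖ ^ 2 < ‖x‖) (h2 : ‖q‖ ^ 2 * ‖x‖ < 1) :
    ∃ a b : ℝ, ‖q‖ ^ 2 < a ∧ ‖q‖ ^ 2 * b < 1 ∧ x ∈ annulus a b := by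
  have hq' : 0 < ‖q‖ ^ 2 := by have := norm_pos_iff.mpr hq0; positivity
  obtain ⟨a, ha, ha'⟩ := exists_between h1
  have h3 : ‖x‖ < (‖q‖ ^ 2)⁻¹ := by rwa [lt_inv_comm₀ (hq'.trans h1) hq', ← one_div,
    lt_div_iff₀ (hq'.trans h1)]
  obtain ⟨b, hb, hb'⟩ := exists_between h3
  refine ⟨a, b, ha, ?_, ha', hb⟩
  have := mul_lt_mul_of_pos_left hb' hq'
  rwa [mul_inv_cancel₀ hq'.ne'] at this

lemma exists_norm_inv_le (hq : ‖q‖ < 1) (hq0 : q ≠ 0) {x : ℂ} (h1 : ‖q‖ ^ 2 < ‖x‖)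
    (h2 : ‖q‖ ^ 2 * ‖x‖ < 1) : ∃ C : ℝ, ∀ r : ℤ, ‖(1 + q ^ (2 * r) * x)⁻¹‖ ≤ C := by
  obtain ⟨a, b, ha, hb, hx⟩ := exists_annulus_mem hq0 h1 h2
  obtain ⟨δ, hδ, h⟩ := exists_le_norm_one_add hq hq0 ha hb
  refine ⟨max δ⁻¹ ‖(1 + x)⁻¹‖, fun r ↦ ?_⟩
  by_cases hr : r = 0
  · subst hr; simp
  · refine le_max_of_le_left ?_
    rw [norm_inv]
    exact inv_anti₀ hδ (h x hx r hr)

lemma summable_appell (hq : ‖q‖ < 1) (hq0 : q ≠ 0) {x : ℂ} (h1 : ‖q‖ ^ 2 < ‖x‖)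
    (h2 : ‖q‖ ^ 2 * ‖x‖ < 1) (w : ℂ) :
    Summable fun r : ℤ ↦ thetaTerm q w r / (1 + q ^ (2 * r) * x) := by
  obtain ⟨C, hC⟩ := exists_norm_inv_le hq hq0 h1 h2
  refine Summable.of_norm_bounded ((summable_norm_thetaTerm hq w).mul_right C) fun r ↦ ?_
  rw [div_eq_mul_inv, norm_mul]
  have := hC r
  gcongr

lemma differentiableAt_appell_right (hq : ‖q‖ < 1) (hq0 : q ≠ 0) {x : ℂ} (h1 : ‖q‖ ^ 2 < ‖x‖)
    (h2 : ‖q‖ ^ 2 * ‖x‖ < 1) {w : ℂ} (hw : w ≠ 0) :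
    DifferentiableAt ℂ (fun w ↦ appell q x w) w := by
  obtain ⟨C, hC⟩ := exists_norm_inv_le hq hq0 h1 h2
  simpa only [appell, div_eq_mul_inv] using differentiableAt_tsum_thetaTerm_mul hq hC hw

lemma differentiableAt_appellReg (hq : ‖q‖ < 1) (hq0 : q ≠ 0) {x : ℂ} (h1 : ‖q‖ ^ 2 < ‖x‖)
    (h2 : ‖q‖ ^ 2 * ‖x‖ < 1) (w : ℂ) :
    DifferentiableAt ℂ (fun x ↦ appellReg q x w) x := by
  obtain ⟨a, b, ha, hb, hx⟩ := exists_annulus_mem hq0 h1 h2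
  obtain ⟨δ, hδ, h⟩ := exists_le_norm_one_add hq hq0 ha hb
  have hd : DifferentiableOn ℂ (fun x ↦ appellReg q x w) (annulus a b) := by
    refine Complex.differentiableOn_tsum_of_summable_norm
      ((summable_norm_thetaTerm hq w).mul_right δ⁻¹) ?_ (isOpen_annulus a b) ?_
    · intro r z hz
      by_cases hr : r = 0
      · simp only [hr, if_true]
        exact differentiableWithinAt_const _
      · simp only [hr, if_false]
        have hne : 1 + q ^ (2 * r) * z ≠ 0 := norm_pos_iff.mp (hδ.trans_le (h z hz r hr))
        exact DifferentiableAt.differentiableWithinAt (by fun_prop (disch := exact hne))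
    · intro r z hz
      by_cases hr : r = 0
      · simp only [hr, if_true, norm_zero]
        positivity
      · simp only [hr, if_false]
        rw [norm_div, div_eq_mul_inv]
        have := inv_anti₀ hδ (h z hz r hr)
        gcongr
  exact hd.differentiableAt ((isOpen_annulus a b).mem_nhds hx)

lemma appell_eq_add_appellReg (hq : ‖q‖ < 1) (hq0 : q ≠ 0) {x : ℂ} (h1 : ‖q‖ ^ 2 < ‖x‖)
    (h2 : ‖q‖ ^ 2 * ‖x‖ < 1) (w : ℂ) : appell q x w = 1 / (1 + x) + appellReg q x w := by
  rw [appell, (summable_appell hq hq0 h1 h2 w).tsum_eq_add_tsum_ite 0, appellReg]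
  simp [thetaTerm]

lemma one_add_zpow_mul_ne_zero (hq : ‖q‖ < 1) (hq0 : q ≠ 0) {x : ℂ} (h1 : ‖q‖ ^ 2 < ‖x‖)
    (h2 : ‖q‖ ^ 2 * ‖x‖ < 1) (hx : x ≠ -1) (r : ℤ) : 1 + q ^ (2 * r) * x ≠ 0 := by
  by_cases hr : r = 0
  · subst hr
    simp only [mul_zero, zpow_zero, one_mul]
    intro h
    exact hx (by linear_combination h)
  · obtain ⟨a, b, ha, hb, hx'⟩ := exists_annulus_mem hq0 h1 h2
    obtain ⟨δ, hδ, h⟩ := exists_le_norm_one_add hq hq0 ha hb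
    exact norm_pos_iff.mp (hδ.trans_le (h x hx' r hr))

lemma appell_sq_mul_right (hq : ‖q‖ < 1) (hq0 : q ≠ 0) {x : ℂ} (h1 : ‖q‖ ^ 2 < ‖x‖)
    (h2 : ‖q‖ ^ 2 * ‖x‖ < 1) (hx : x ≠ -1) (w : ℂ) :
    x * appell q x (q ^ 2 * w) = theta q w - appell q x w := by
  rw [theta, appell, appell, ← (summable_norm_thetaTerm hq w).of_norm.tsum_sub
    (summable_appell hq hq0 h1 h2 w), ← tsum_mul_left]
  congr 1
  ext r
  have h := one_add_zpow_mul_ne_zero hq hq0 h1 h2 hx r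
  rw [thetaTerm_sq_mul]
  generalize q ^ (2 * r) = t at h ⊢
  rw [eq_sub_iff_add_eq, ← mul_div_assoc, ← add_div, div_eq_iff h]
  ring

lemma appell_sq_mul_left (hq : ‖q‖ < 1) (hq0 : q ≠ 0) {x : ℂ} (h1 : ‖q‖ ^ 2 < ‖x‖)
    (h2 : ‖q‖ ^ 2 * ‖x‖ < 1) (hx : x ≠ -1) {w : ℂ} (hw : w ≠ 0) :
    appell q (q ^ 2 * x) w = q * x / w * appell q x w + theta q w := by
  set f : ℤ → ℂ := fun r ↦ thetaTerm q w r / (1 + q ^ (2 * r) * x) with hf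
  have hs : Summable f := summable_appell hq hq0 h1 h2 w
  have hs' : Summable fun r : ℤ ↦ q * x / w * f (r + 1) :=
    (hs.comp_injective (add_left_injective (1 : ℤ))).mul_left _
  have he : ∑' r : ℤ, f (r + 1) = appell q x w := (Equiv.addRight (1 : ℤ)).tsum_eq f
  rw [← he, theta, appell, ← tsum_mul_left, ← hs'.tsum_add (summable_norm_thetaTerm hq w).of_norm]
  refine tsum_congr fun r ↦ ?_
  have h := one_add_zpow_mul_ne_zero hq hq0 h1 h2 hx (r + 1)
  have e : q ^ (2 * (r + 1)) = q ^ 2 * q ^ (2 * r) := by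
    rw [mul_add, zpow_add₀ hq0, mul_comm]; norm_cast
  simp only [hf]
  rw [thetaTerm_add_one hq0 hw]
  rw [e] at h ⊢
  generalize q ^ (2 * r) = t at h ⊢
  have h' : 1 + t * (q ^ 2 * x) ≠ 0 := by
    intro hh; exact h (by linear_combination hh)
  rw [show 1 + q ^ 2 * t * x = 1 + t * (q ^ 2 * x) by ring, div_eq_iff h', add_mul, mul_assoc,
    div_mul_cancel₀ _ h']
  field_simp
  ring

/-- The Lambert-type series `∑_{r ≥ 0} x^r / (1 - z q^r)`. -/
def lambert (q x z : ℂ) : ℂ := ∑' r : ℕ, x ^ r / (1 - z * q ^ r)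

/-- The Lambert-type series without its term at `r = 0`. -/
def lambertReg (q x z : ℂ) : ℂ := ∑' r : ℕ, if r = 0 then 0 else x ^ r / (1 - z * q ^ r)

/-- Kronecker's series `∑_{r ∈ ℤ} x^r / (1 - z q^r)`, with its two halves summed separately. -/
def kronecker (q x z : ℂ) : ℂ := lambert q x z - q / (x * z) * lambert q (q / x) (q / z)

/-- The terms of `doubleSum`. -/
def doubleTerm (q x y z : ℂ) (p : ℕ × ℕ) : ℂ :=
  q ^ (p.1 * p.2) * x ^ p.1 * y ^ p.2 / (1 - z * q ^ (p.1 + p.2))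

/-- The double series `∑_{r, s ≥ 0} q^{rs} x^r y^s / (1 - z q^{r+s})`. -/
def doubleSum (q x y z : ℂ) : ℂ := ∑' p : ℕ × ℕ, doubleTerm q x y z p

/-- The double series without its term at `(0, 0)`. -/
def doubleSumReg (q x y z : ℂ) : ℂ := ∑' p : ℕ × ℕ, if p = 0 then 0 else doubleTerm q x y z p

/-- The meromorphic continuation in `z` of the triple sum. -/
def heckeSum (q x y z : ℂ) : ℂ :=
  doubleSum q x y z + q ^ 3 / (x * y * z) * doubleSum q (q ^ 2 / x) (q ^ 2 / y) (q ^ 2 / z)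

lemma exists_norm_one_sub_inv_le (hq : ‖q‖ < 1) (z : ℂ) :
    ∃ C : ℝ, ∀ n : ℕ, ‖(1 - z * q ^ n)⁻¹‖ ≤ C := by
  have h : Tendsto (fun n : ℕ ↦ (1 - z * q ^ n)⁻¹) atTop (𝓝 1) := by
    have h1 := (tendsto_pow_atTop_nhds_zero_of_norm_lt_one hq).const_mul z
    have h2 := (h1.const_sub 1).inv₀ (by simp)
    simpa using h2
  obtain ⟨C, hC⟩ := (Metric.isBounded_range_of_tendsto _ h).exists_norm_le
  exact ⟨C, fun n ↦ hC _ ⟨n, rfl⟩⟩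

lemma summable_lambert (hq : ‖q‖ < 1) {x : ℂ} (hx : ‖x‖ < 1) (z : ℂ) :
    Summable fun r : ℕ ↦ x ^ r / (1 - z * q ^ r) := by
  obtain ⟨C, hC⟩ := exists_norm_one_sub_inv_le hq z
  refine Summable.of_norm_bounded
    ((summable_geometric_of_lt_one (norm_nonneg x) hx).mul_right C) fun r ↦ ?_
  rw [div_eq_mul_inv, norm_mul, norm_pow]
  have := hC r
  gcongr

lemma summable_pow_mul_pow {x y : ℂ} (hx : ‖x‖ < 1) (hy : ‖y‖ < 1) :
    Summable fun p : ℕ × ℕ ↦ ‖x‖ ^ p.1 * ‖y‖ ^ p.2 :=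
  (summable_geometric_of_lt_one (norm_nonneg x) hx).mul_of_nonneg
    (summable_geometric_of_lt_one (norm_nonneg y) hy) (fun _ ↦ by positivity)
    (fun _ ↦ by positivity)

lemma norm_pow_mul_pow_mul_pow_le (hq : ‖q‖ < 1) (x y : ℂ) (n r s : ℕ) :
    ‖q ^ n * x ^ r * y ^ s‖ ≤ ‖x‖ ^ r * ‖y‖ ^ s := by
  rw [norm_mul, norm_mul, norm_pow, norm_pow, norm_pow]
  have : ‖q‖ ^ n ≤ 1 := pow_le_one₀ (norm_nonneg _) hq.le
  gcongr
  exact mul_le_of_le_one_left (by positivity) this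

lemma summable_doubleTerm (hq : ‖q‖ < 1) {x y : ℂ} (hx : ‖x‖ < 1) (hy : ‖y‖ < 1) (z : ℂ) :
    Summable (doubleTerm q x y z) := by
  obtain ⟨C, hC⟩ := exists_norm_one_sub_inv_le hq z
  refine Summable.of_norm_bounded ((summable_pow_mul_pow hx hy).mul_right C) fun p ↦ ?_
  rw [doubleTerm, div_eq_mul_inv, norm_mul]
  have h1 := hC (p.1 + p.2)
  have h2 := norm_pow_mul_pow_mul_pow_le hq x y (p.1 * p.2) p.1 p.2
  gcongr

lemma lambert_eq_add (hq : ‖q‖ < 1) {x : ℂ} (hx : ‖x‖ < 1) (z : ℂ) :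
    lambert q x z = 1 / (1 - z) + x * lambert q x (q * z) := by
  rw [lambert, (summable_lambert hq hx z).tsum_eq_zero_add, lambert, ← tsum_mul_left]
  congr 1
  · simp
  · congr 1
    ext r
    rw [pow_succ, pow_succ, show z * (q ^ r * q) = q * z * q ^ r by ring]
    ring

lemma kronecker_mul (hq : ‖q‖ < 1) (hq0 : q ≠ 0) {x z : ℂ} (h1 : ‖q‖ < ‖x‖) (h2 : ‖x‖ < 1)
    (hz : z ≠ 0) (hz1 : z ≠ 1) : x * kronecker q x (q * z) = kronecker q x z := by
  have hx' : 0 < ‖x‖ := (norm_nonneg q).trans_lt h1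
  have hx : x ≠ 0 := norm_pos_iff.mp hx'
  have hqx : ‖q / x‖ < 1 := by rwa [norm_div, div_lt_one hx']
  have e1 := lambert_eq_add hq h2 z
  have e2 := lambert_eq_add hq hqx (1 / z)
  have e3 : q / (q * z) = 1 / z := by field_simp
  have e4 : q * (1 / z) = q / z := by ring
  have hz2 : 1 - z ≠ 0 := sub_ne_zero.mpr (Ne.symm hz1)
  have hz3 : z - 1 ≠ 0 := sub_ne_zero.mpr hz1
  have e5 : 1 / (1 - 1 / z) = -z * (1 / (1 - z)) := by
    rw [one_sub_div hz, one_div_div, ← neg_sub 1 z, div_neg]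
    ring
  rw [kronecker, kronecker, e3, e1, e2, e4, e5]
  field_simp
  ring

lemma doubleSum_comm (q x y z : ℂ) : doubleSum q x y z = doubleSum q y x z := by
  rw [doubleSum, doubleSum, ← (Equiv.prodComm ℕ ℕ).tsum_eq]
  congr 1
  ext p
  simp only [doubleTerm, Equiv.prodComm_apply, Prod.fst_swap, Prod.snd_swap]
  rw [mul_comm p.2, add_comm p.2]
  ring

lemma norm_mul_lt_one (hq : ‖q‖ < 1) {x : ℂ} (hx : ‖x‖ < 1) : ‖q * x‖ < 1 := by
  rw [norm_mul]; nlinarith [norm_nonneg x, norm_nonneg q]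

lemma doubleSum_eq_add (hq : ‖q‖ < 1) {x y : ℂ} (hx : ‖x‖ < 1) (hy : ‖y‖ < 1) (z : ℂ) :
    doubleSum q x y z = lambert q y z + x * doubleSum q x (q * y) (q * z) := by
  have hs := summable_doubleTerm hq hx hy z
  have hs' := summable_doubleTerm hq hx (norm_mul_lt_one hq hy) (q * z)
  rw [doubleSum, hs.tsum_prod, hs.prod.tsum_eq_zero_add, lambert, doubleSum, hs'.tsum_prod,
    ← tsum_mul_left]
  congr 1
  · simp [doubleTerm]
  · congr 1
    ext r
    rw [← tsum_mul_left]
    congr 1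
    ext s
    simp only [doubleTerm]
    rw [show z * q ^ (r + 1 + s) = q * z * q ^ (r + s) by ring]
    ring

lemma tsum_pow_mul_pow_mul_pow (hq : ‖q‖ < 1) {x y : ℂ} (hx : ‖x‖ < 1) (hy : ‖y‖ < 1) :
    Summable (fun p : ℕ × ℕ ↦ q ^ (p.1 * p.2) * x ^ p.1 * y ^ p.2) ∧
    ∑' p : ℕ × ℕ, q ^ (p.1 * p.2) * x ^ p.1 * y ^ p.2 = lambert q x y := by
  have hs : Summable (fun p : ℕ × ℕ ↦ q ^ (p.1 * p.2) * x ^ p.1 * y ^ p.2) :=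
    Summable.of_norm_bounded (summable_pow_mul_pow hx hy) fun p ↦
      norm_pow_mul_pow_mul_pow_le hq x y (p.1 * p.2) p.1 p.2
  refine ⟨hs, ?_⟩
  rw [hs.tsum_prod, lambert]
  congr 1
  ext r
  have hr : ‖y * q ^ r‖ < 1 := by
    rw [norm_mul, norm_pow]
    have : ‖q‖ ^ r ≤ 1 := pow_le_one₀ (norm_nonneg _) hq.le
    nlinarith [norm_nonneg y]
  rw [div_eq_mul_inv, ← tsum_geometric_of_norm_lt_one hr, ← tsum_mul_left]
  congr 1
  ext s
  rw [mul_pow, ← pow_mul]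
  ring

lemma doubleSum_eq_add' (hq : ‖q‖ < 1) {x y : ℂ} (hx : ‖x‖ < 1) (hy : ‖y‖ < 1) {z : ℂ}
    (hz : ∀ n : ℕ, z * q ^ n ≠ 1) :
    doubleSum q x y z = lambert q x y + z * doubleSum q (q * x) (q * y) z := by
  obtain ⟨hs, he⟩ := tsum_pow_mul_pow_mul_pow hq hx hy
  have hs' := (summable_doubleTerm hq (norm_mul_lt_one hq hx) (norm_mul_lt_one hq hy) z).mul_left z
  rw [← he, doubleSum, doubleSum, ← tsum_mul_left, ← hs.tsum_add hs']
  congr 1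
  ext p
  have h : 1 - z * q ^ (p.1 + p.2) ≠ 0 := sub_ne_zero.mpr (hz _).symm
  simp only [doubleTerm]
  rw [← mul_div_assoc, div_eq_iff h, add_mul, div_mul_cancel₀ _ h]
  ring

lemma heckeSum_comm (q x y z : ℂ) : heckeSum q x y z = heckeSum q y x z := by
  rw [heckeSum, heckeSum, doubleSum_comm q x y, doubleSum_comm q (q ^ 2 / x), mul_comm x y]

lemma norm_div_lt_one {a b : ℂ} (h : ‖a‖ < ‖b‖) : ‖a / b‖ < 1 := by
  rwa [norm_div, div_lt_one ((norm_nonneg a).trans_lt h)]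

lemma heckeSum_eq_add (hq : ‖q‖ < 1) (hq0 : q ≠ 0) {x y z : ℂ} (hx1 : ‖q ^ 2‖ < ‖x‖)
    (hx2 : ‖x‖ < 1) (hy1 : ‖q‖ < ‖y‖) (hy2 : ‖y‖ < 1) (hz : z ≠ 0) :
    heckeSum q x y z = kronecker q y z + x * heckeSum q x (q * y) (q * z) := by
  have hx : x ≠ 0 := norm_pos_iff.mp ((norm_nonneg _).trans_lt hx1)
  have hy : y ≠ 0 := norm_pos_iff.mp ((norm_nonneg _).trans_lt hy1)
  have e1 := doubleSum_eq_add hq hx2 hy2 z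
  have e2 := doubleSum_eq_add hq (norm_div_lt_one hx1) (norm_div_lt_one hy1) (q / z)
  have e3 : q ^ 2 / (q * y) = q / y := by field_simp
  have e4 : q ^ 2 / (q * z) = q / z := by field_simp
  have e5 : q * (q / y) = q ^ 2 / y := by ring
  have e6 : q * (q / z) = q ^ 2 / z := by ring
  rw [heckeSum, heckeSum, kronecker, e3, e4, e1, e2, e5, e6]
  field_simp
  ring

lemma heckeSum_eq_add' (hq : ‖q‖ < 1) (hq0 : q ≠ 0) {x y z : ℂ} (hx1 : ‖q‖ < ‖x‖)
    (hx2 : ‖x‖ < 1) (hy1 : ‖q‖ < ‖y‖) (hy2 : ‖y‖ < 1) (hz : ∀ n : ℕ, z * q ^ n ≠ 1)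
    (hz0 : z ≠ 0) (hz' : ∀ n : ℕ, q ^ 2 / z * q ^ n ≠ 1) :
    heckeSum q x y z = kronecker q x y + z * heckeSum q (q * x) (q * y) z := by
  have hx : x ≠ 0 := norm_pos_iff.mp ((norm_nonneg _).trans_lt hx1)
  have hy : y ≠ 0 := norm_pos_iff.mp ((norm_nonneg _).trans_lt hy1)
  have e1 := doubleSum_eq_add' hq hx2 hy2 hz
  have e2 := doubleSum_eq_add' hq (norm_div_lt_one hx1) (norm_div_lt_one hy1) hz'
  have e3 : q ^ 2 / (q * y) = q / y := by field_simp
  have e4 : q ^ 2 / (q * x) = q / x := by field_simp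
  have e5 : q * (q / y) = q ^ 2 / y := by ring
  have e6 : q * (q / x) = q ^ 2 / x := by ring
  rw [heckeSum, heckeSum, kronecker, e3, e4, e1, e2, e5, e6]
  field_simp
  ring

lemma norm_sq_lt (hq : ‖q‖ < 1) {x : ℂ} (h : ‖q‖ < ‖x‖) : ‖q ^ 2‖ < ‖x‖ := by
  rw [norm_pow]; nlinarith [norm_nonneg q]

/-- The quasi-periodicity of the triple sum in `z` under multiplication by `q²`. -/
lemma heckeSum_sq_mul (hq : ‖q‖ < 1) (hq0 : q ≠ 0) {x y z : ℂ} (hx1 : ‖q‖ < ‖x‖)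
    (hx2 : ‖x‖ < 1) (hy1 : ‖q‖ < ‖y‖) (hy2 : ‖y‖ < 1) (hz1 : 1 < ‖z‖) (hz2 : ‖q‖ * ‖z‖ < 1) :
    heckeSum q x y (q ^ 2 * z) = kronecker q x y
      + q * z / (x * y) * (heckeSum q x y z - kronecker q y z - kronecker q x z) := by
  have hx : x ≠ 0 := norm_pos_iff.mp ((norm_nonneg _).trans_lt hx1)
  have hy : y ≠ 0 := norm_pos_iff.mp ((norm_nonneg _).trans_lt hy1)
  have hz : z ≠ 0 := norm_pos_iff.mp (zero_lt_one.trans hz1)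
  have hq' : 0 < ‖q‖ := norm_pos_iff.mpr hq0
  have hlt : ∀ w : ℂ, ‖w‖ < 1 → ∀ n : ℕ, w * q ^ n ≠ 1 := by
    intro w hw n h
    have h1 : ‖w * q ^ n‖ = 1 := by rw [h, norm_one]
    rw [norm_mul, norm_pow] at h1
    have : ‖q‖ ^ n ≤ 1 := pow_le_one₀ (norm_nonneg _) hq.le
    nlinarith [norm_nonneg w, pow_nonneg (norm_nonneg q) n]
  have e1 : heckeSum q x y (q ^ 2 * z)
      = kronecker q x y + q ^ 2 * z * heckeSum q (q * x) (q * y) (q ^ 2 * z) := by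
    refine heckeSum_eq_add' hq hq0 hx1 hx2 hy1 hy2 (hlt _ ?_)
      (mul_ne_zero (pow_ne_zero 2 hq0) hz) (hlt _ ?_)
    · rw [norm_mul, norm_pow]; nlinarith
    · rw [mul_comm, ← div_div, div_right_comm, div_self (pow_ne_zero 2 hq0), norm_div, norm_one]
      exact (div_lt_one (by linarith)).mpr hz1
  have e2 := heckeSum_eq_add hq hq0 (norm_sq_lt hq hx1) hx2 hy1 hy2 hz
  have e3 := heckeSum_eq_add hq hq0 (x := q * y) (y := x) (z := q * z)
    (by rw [norm_pow, norm_mul]; nlinarith) (norm_mul_lt_one hq hy2) hx1 hx2 (mul_ne_zero hq0 hz)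
  have e4 := kronecker_mul hq hq0 hx1 hx2 hz (by rintro rfl; simp at hz1)
  rw [heckeSum_comm q (q * y), heckeSum_comm q (q * y), ← mul_assoc q q z, ← pow_two] at e3
  rw [e1, e2, e3, ← e4]
  field_simp
  ring

/-- Differentiability of `∑ a_i / (1 - z q^{n_i})` off the poles with `n_i = 0`. -/
lemma differentiableAt_tsum_div {ι : Type*} (hq : ‖q‖ < 1) {a : ι → ℂ} {n : ι → ℕ}
    (ha : Summable fun i ↦ ‖a i‖) (h0 : ∀ i, n i = 0 → a i = 0) {z : ℂ} (hz : ‖q‖ * ‖z‖ < 1) :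
    DifferentiableAt ℂ (fun z ↦ ∑' i, a i / (1 - z * q ^ n i)) z := by
  obtain ⟨b, hzb, hb⟩ : ∃ b : ℝ, ‖z‖ < b ∧ ‖q‖ * b < 1 := by
    have hc : Tendsto (fun b : ℝ ↦ ‖q‖ * b) (𝓝[>] ‖z‖) (𝓝 (‖q‖ * ‖z‖)) :=
      ((continuous_const.mul continuous_id).tendsto _).mono_left nhdsWithin_le_nhds
    obtain ⟨b, hb1, hb2⟩ := ((hc.eventually_lt_const hz).and self_mem_nhdsWithin).exists
    exact ⟨b, hb2, hb1⟩
  have hδ : 0 < 1 - ‖q‖ * b := by linarith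
  have hlow : ∀ w ∈ Metric.ball (0 : ℂ) b, ∀ k : ℕ, k ≠ 0 → 1 - ‖q‖ * b ≤ ‖1 - w * q ^ k‖ := by
    intro w hw k hk
    have hw' : ‖w‖ < b := by simpa using hw
    have h1 := norm_sub_norm_le (1 : ℂ) (w * q ^ k)
    rw [norm_one, norm_mul, norm_pow] at h1
    have h2 : ‖q‖ ^ k ≤ ‖q‖ := pow_le_of_le_one (norm_nonneg _) hq.le hk
    have h3 : ‖w‖ * ‖q‖ ^ k ≤ b * ‖q‖ := by
      have : 0 ≤ b := (norm_nonneg w).trans hw'.le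
      gcongr
    linarith
  have hd : DifferentiableOn ℂ (fun z ↦ ∑' i, a i / (1 - z * q ^ n i)) (Metric.ball 0 b) := by
    refine Complex.differentiableOn_tsum_of_summable_norm (ha.mul_right (1 - ‖q‖ * b)⁻¹) ?_
      Metric.isOpen_ball ?_
    · intro i w hw
      by_cases hi : n i = 0
      · simp only [h0 i hi, zero_div]
        exact differentiableWithinAt_const _
      · have hne : 1 - w * q ^ n i ≠ 0 := norm_pos_iff.mp (hδ.trans_le (hlow w hw _ hi))
        exact DifferentiableAt.differentiableWithinAt (by fun_prop (disch := exact hne))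
    · intro i w hw
      by_cases hi : n i = 0
      · simp [h0 i hi]
      · rw [norm_div, div_eq_mul_inv]
        have := inv_anti₀ hδ (hlow w hw _ hi)
        gcongr
  exact hd.differentiableAt (Metric.isOpen_ball.mem_nhds (by simpa using hzb))

lemma differentiableAt_lambertReg (hq : ‖q‖ < 1) {x z : ℂ} (hx : ‖x‖ < 1) (hz : ‖q‖ * ‖z‖ < 1) :
    DifferentiableAt ℂ (fun z ↦ lambertReg q x z) z := by
  have hs : Summable fun r : ℕ ↦ ‖if r = 0 then (0 : ℂ) else x ^ r‖ := by
    refine (summable_geometric_of_lt_one (norm_nonneg x) hx).of_nonneg_of_le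
      (fun _ ↦ norm_nonneg _) fun r ↦ ?_
    split_ifs <;> simp
  have := differentiableAt_tsum_div hq (n := fun r ↦ r) hs (fun i hi ↦ if_pos hi) hz
  simpa only [lambertReg, ite_div, zero_div] using this

lemma lambert_eq_add_lambertReg (hq : ‖q‖ < 1) {x : ℂ} (hx : ‖x‖ < 1) (z : ℂ) :
    lambert q x z = 1 / (1 - z) + lambertReg q x z := by
  rw [lambert, (summable_lambert hq hx z).tsum_eq_add_tsum_ite 0, lambertReg]
  simp

lemma differentiableAt_lambert (hq : ‖q‖ < 1) {x z : ℂ} (hx : ‖x‖ < 1) (hz : ‖q‖ * ‖z‖ < 1)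
    (hz1 : z ≠ 1) : DifferentiableAt ℂ (fun z ↦ lambert q x z) z := by
  have h : 1 - z ≠ 0 := sub_ne_zero.mpr hz1.symm
  simp only [lambert_eq_add_lambertReg hq hx]
  exact DifferentiableAt.add (by fun_prop (disch := exact h)) (differentiableAt_lambertReg hq hx hz)

lemma differentiableAt_doubleSumReg (hq : ‖q‖ < 1) {x y z : ℂ} (hx : ‖x‖ < 1) (hy : ‖y‖ < 1)
    (hz : ‖q‖ * ‖z‖ < 1) : DifferentiableAt ℂ (fun z ↦ doubleSumReg q x y z) z := by
  have hs : Summable fun p : ℕ × ℕ ↦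
      ‖if p = 0 then (0 : ℂ) else q ^ (p.1 * p.2) * x ^ p.1 * y ^ p.2‖ := by
    refine (summable_pow_mul_pow hx hy).of_nonneg_of_le (fun _ ↦ norm_nonneg _) fun p ↦ ?_
    split_ifs
    · rw [norm_zero]; positivity
    · exact norm_pow_mul_pow_mul_pow_le hq x y _ _ _
  have := differentiableAt_tsum_div hq (n := fun p : ℕ × ℕ ↦ p.1 + p.2) hs
    (fun p hp ↦ if_pos (by ext <;> simp <;> omega)) hz
  simpa only [doubleSumReg, doubleTerm, ite_div, zero_div] using this

lemma doubleSum_eq_add_doubleSumReg (hq : ‖q‖ < 1) {x y : ℂ} (hx : ‖x‖ < 1) (hy : ‖y‖ < 1)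
    (z : ℂ) : doubleSum q x y z = 1 / (1 - z) + doubleSumReg q x y z := by
  rw [doubleSum, (summable_doubleTerm hq hx hy z).tsum_eq_add_tsum_ite 0, doubleSumReg]
  simp [doubleTerm]

lemma differentiableAt_doubleSum (hq : ‖q‖ < 1) {x y z : ℂ} (hx : ‖x‖ < 1) (hy : ‖y‖ < 1)
    (hz : ‖q‖ * ‖z‖ < 1) (hz1 : z ≠ 1) : DifferentiableAt ℂ (fun z ↦ doubleSum q x y z) z := by
  have h : 1 - z ≠ 0 := sub_ne_zero.mpr hz1.symm
  simp only [doubleSum_eq_add_doubleSumReg hq hx hy]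
  exact DifferentiableAt.add (by fun_prop (disch := exact h))
    (differentiableAt_doubleSumReg hq hx hy hz)

/-- Kronecker's identity. -/
lemma kronecker_eq (hq : ‖q‖ < 1) (hq0 : q ≠ 0) {y z : ℂ} (hy1 : ‖q‖ < ‖y‖) (hy2 : ‖y‖ < 1)
    (hz1 : ‖q‖ < ‖z‖) (hz2 : ‖q‖ * ‖z‖ < 1) (hz : z ≠ 1) :
    j y q * j z q * kronecker q y z = J 1 q ^ 3 * j (y * z) q := by
  have hq' : 0 < ‖q‖ := norm_pos_iff.mpr hq0
  have hy : y ≠ 0 := norm_pos_iff.mp (hq'.trans hy1)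
  have hinv : 1 < ‖q‖⁻¹ := (one_lt_inv₀ hq').mpr hq
  have hmem : ∀ w : ℂ, w ∈ annulus ‖q‖ ‖q‖⁻¹ ↔ ‖q‖ < ‖w‖ ∧ ‖q‖ * ‖w‖ < 1 := fun w ↦ by
    rw [annulus, Set.mem_ofPred_eq, ← one_div, lt_div_iff₀ hq', mul_comm ‖w‖]
  have hqy := norm_div_lt_one hy1
  set f : ℂ → ℂ := fun z ↦ jReg z q + j z q *
    (lambertReg q y z - q / (y * z) * lambert q (q / y) (q / z)) with hf
  have hfK : ∀ w : ℂ, w ≠ 1 → f w = j w q * kronecker q y w := by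
    intro w hw
    have : 1 - w ≠ 0 := sub_ne_zero.mpr hw.symm
    simp only [hf, kronecker, lambert_eq_add_lambertReg hq hy2 w, j_eq_mul_jReg hq w]
    field_simp
    ring
  have hfd : DifferentiableOn ℂ f (annulus ‖q‖ ‖q‖⁻¹) := by
    intro w hw
    obtain ⟨hw1, hw2⟩ := (hmem w).mp hw
    have hw0 : w ≠ 0 := norm_pos_iff.mp (hq'.trans hw1)
    have hqw := norm_div_lt_one hw1
    have h1 : DifferentiableAt ℂ (fun z ↦ lambert q (q / y) (q / z)) w := by
      refine DifferentiableAt.comp w (f := fun z ↦ q / z)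
        (differentiableAt_lambert hq hqy (z := q / w) ?_ ?_)
        (by fun_prop (disch := exact hw0))
      · nlinarith [norm_nonneg (q / w)]
      · intro h; rw [h, norm_one] at hqw; exact lt_irrefl _ hqw
    have h2 : DifferentiableAt ℂ (fun z ↦ q / (y * z)) w := by
      have : y * w ≠ 0 := mul_ne_zero hy hw0
      fun_prop (disch := exact this)
    exact ((differentiableAt_jReg hq hw0).add ((differentiableAt_j hq hw0).mul
      ((differentiableAt_lambertReg hq hy2 hw2).sub (h2.mul h1)))).differentiableWithinAt
  obtain ⟨r, hr1, hr2⟩ := exists_between hinv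
  have hcross := mul_eq_mul_of_quasiPeriodic hq'.le hq0 hq (c := -y⁻¹)
    (neg_ne_zero.mpr (inv_ne_zero hy)) hfd (g := fun z ↦ j (y * z) q) (r := r)
    (fun w hw ↦ (differentiableAt_j_comp hq (f := fun z ↦ y * z) (by fun_prop)
      (mul_ne_zero hy (norm_pos_iff.mp (hq'.trans hw.1)))).differentiableWithinAt)
    (by nlinarith) hr2
    (fun w hw ↦ by
      have hw0 : w ≠ 0 := norm_pos_iff.mp (by rw [hw]; linarith)
      have hw1 : w ≠ 1 := by rintro rfl; rw [norm_one] at hw; linarith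
      have hqw1 : q * w ≠ 1 := by
        intro h
        have : ‖q * w‖ = 1 := by rw [h, norm_one]
        rw [norm_mul, hw] at this
        have := mul_lt_mul_of_pos_left hr2 hq'
        rw [mul_inv_cancel₀ hq'.ne'] at this
        linarith
      rw [hfK _ hqw1, hfK _ hw1, j_mul hq hq0 hw0, ← kronecker_mul hq hq0 hy1 hy2 hw0 hw1]
      field_simp)
    (fun w hw ↦ by
      have hw0 : w ≠ 0 := norm_pos_iff.mp (by rw [hw]; linarith)
      rw [show y * (q * w) = q * (y * w) by ring, j_mul hq hq0 (mul_ne_zero hy hw0), mul_inv]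
      ring)
    ((hmem z).mpr ⟨hz1, hz2⟩) ((hmem 1).mpr ⟨by simpa using hq, by simpa using hq⟩)
  have hf1 : f 1 = J 1 q ^ 3 := by
    simp only [hf, j_one hq, jReg_one, J, pow_one, zero_mul, add_zero]
  rw [hfK z hz, hf1] at hcross
  simp only [mul_one] at hcross
  rw [← hcross]
  ring

/-- The terms `q^{rs+rt+st} x^r y^s z^t` with natural exponents. -/
def natTerm (q x y z : ℂ) (p : ℕ × ℕ × ℕ) : ℂ :=
  q ^ (p.1 * p.2.1 + p.1 * p.2.2 + p.2.1 * p.2.2) * x ^ p.1 * y ^ p.2.1 * z ^ p.2.2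

/-- The sum `∑_{r,s,t ≥ 0} q^{rs+rt+st} x^r y^s z^t`. -/
def natSum (q x y z : ℂ) : ℂ := ∑' p : ℕ × ℕ × ℕ, natTerm q x y z p

lemma norm_natTerm_le (hq : ‖q‖ < 1) {x y z : ℂ} {a b c : ℝ} (hx : ‖x‖ ≤ a) (hy : ‖y‖ ≤ b)
    (hz : ‖z‖ ≤ c) (p : ℕ × ℕ × ℕ) :
    ‖natTerm q x y z p‖ ≤ a ^ p.1 * (b ^ p.2.1 * c ^ p.2.2) := by
  rw [natTerm, norm_mul, norm_mul, norm_mul, norm_pow, norm_pow, norm_pow, norm_pow, mul_assoc]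
  have : ‖q‖ ^ (p.1 * p.2.1 + p.1 * p.2.2 + p.2.1 * p.2.2) ≤ 1 :=
    pow_le_one₀ (norm_nonneg _) hq.le
  have ha : 0 ≤ a := (norm_nonneg x).trans hx
  have hb : 0 ≤ b := (norm_nonneg y).trans hy
  gcongr
  calc _ ≤ 1 * a ^ p.1 := by gcongr
    _ = a ^ p.1 := one_mul _

lemma summable_pow_mul_pow_mul_pow {a b c : ℝ} (ha0 : 0 ≤ a) (ha : a < 1) (hb0 : 0 ≤ b)
    (hb : b < 1) (hc0 : 0 ≤ c) (hc : c < 1) :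
    Summable fun p : ℕ × ℕ × ℕ ↦ a ^ p.1 * (b ^ p.2.1 * c ^ p.2.2) :=
  (summable_geometric_of_lt_one ha0 ha).mul_of_nonneg
    ((summable_geometric_of_lt_one hb0 hb).mul_of_nonneg (summable_geometric_of_lt_one hc0 hc)
      (fun _ ↦ by positivity) (fun _ ↦ by positivity))
    (fun _ ↦ by positivity) (fun _ ↦ by positivity)

lemma summable_natTerm (hq : ‖q‖ < 1) {x y z : ℂ} (hx : ‖x‖ < 1) (hy : ‖y‖ < 1) (hz : ‖z‖ < 1) :
    Summable (natTerm q x y z) :=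
  Summable.of_norm_bounded (summable_pow_mul_pow_mul_pow (norm_nonneg x) hx (norm_nonneg y) hy
    (norm_nonneg z) hz) fun p ↦ norm_natTerm_le hq le_rfl le_rfl le_rfl p

lemma doubleSum_eq_natSum (hq : ‖q‖ < 1) {x y z : ℂ} (hx : ‖x‖ < 1) (hy : ‖y‖ < 1)
    (hz : ‖z‖ < 1) : doubleSum q x y z = natSum q x y z := by
  have hs := (Equiv.prodAssoc ℕ ℕ ℕ).summable_iff.mpr (summable_natTerm hq hx hy hz)
  rw [natSum, ← (Equiv.prodAssoc ℕ ℕ ℕ).tsum_eq]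
  refine Eq.trans ?_ hs.tsum_prod.symm
  rw [doubleSum]
  refine tsum_congr fun p ↦ ?_
  have hr : ‖z * q ^ (p.1 + p.2)‖ < 1 := by
    rw [norm_mul, norm_pow]
    have : ‖q‖ ^ (p.1 + p.2) ≤ 1 := pow_le_one₀ (norm_nonneg _) hq.le
    nlinarith [norm_nonneg z]
  rw [doubleTerm, div_eq_mul_inv, ← tsum_geometric_of_norm_lt_one hr, ← tsum_mul_left]
  refine tsum_congr fun t ↦ ?_
  simp only [natTerm, Function.comp, Equiv.prodAssoc_apply]
  rw [mul_pow, ← pow_mul]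
  ring

lemma natSum_comm (q x y z : ℂ) : natSum q x y z = natSum q x z y := by
  rw [natSum, natSum, ← ((Equiv.refl ℕ).prodCongr (Equiv.prodComm ℕ ℕ)).tsum_eq]
  refine tsum_congr fun p ↦ ?_
  simp only [natTerm, Equiv.prodCongr_apply, Prod.map, Equiv.refl_apply, Equiv.prodComm_apply,
    Prod.fst_swap, Prod.snd_swap]
  ring

lemma heckeSum_eq_natSum (hq : ‖q‖ < 1) {x y z : ℂ} (hx : ‖x‖ < 1) (hy : ‖y‖ < 1)
    (hz : ‖z‖ < 1) (hx' : ‖q ^ 2‖ < ‖x‖) (hy' : ‖q ^ 2‖ < ‖y‖) (hz' : ‖q ^ 2‖ < ‖z‖) :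
    heckeSum q x y z = natSum q x y z
      + q ^ 3 / (x * y * z) * natSum q (q ^ 2 / x) (q ^ 2 / y) (q ^ 2 / z) := by
  rw [heckeSum, doubleSum_eq_natSum hq hx hy hz, doubleSum_eq_natSum hq (norm_div_lt_one hx')
    (norm_div_lt_one hy') (norm_div_lt_one hz')]

/-- The octant of nonnegative triples. -/
def nonnegEquiv : ℕ × ℕ × ℕ ≃ nonnegTriples where
  toFun p := ⟨(p.1, p.2.1, p.2.2), by simp [nonnegTriples]⟩
  invFun p := (p.1.1.toNat, p.1.2.1.toNat, p.1.2.2.toNat)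
  left_inv p := by simp
  right_inv p := by
    obtain ⟨⟨r, s, t⟩, h1, h2, h3⟩ := p
    exact Subtype.ext (Prod.ext (Int.toNat_of_nonneg h1) (Prod.ext (Int.toNat_of_nonneg h2)
      (Int.toNat_of_nonneg h3)))

/-- The octant of negative triples. -/
def negEquiv : ℕ × ℕ × ℕ ≃ negTriples where
  toFun p := ⟨(-p.1 - 1, -p.2.1 - 1, -p.2.2 - 1), by
    refine ⟨?_, ?_, ?_⟩ <;> simp only <;> omega⟩
  invFun p := ((-p.1.1 - 1).toNat, (-p.1.2.1 - 1).toNat, (-p.1.2.2 - 1).toNat)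
  left_inv p := by ext <;> simp
  right_inv p := by
    obtain ⟨⟨r, s, t⟩, h1, h2, h3⟩ := p
    simp only at h1 h2 h3
    refine Subtype.ext (Prod.ext ?_ (Prod.ext ?_ ?_)) <;> simp only <;> omega

lemma term_nonnegEquiv (q x y z : ℂ) (p : ℕ × ℕ × ℕ) :
    term q x y z (nonnegEquiv p) = natTerm q x y z p := by
  simp only [term, natTerm, nonnegEquiv, Equiv.coe_fn_mk]
  norm_cast

lemma zpow_neg_sub_one {x : ℂ} (hx : x ≠ 0) (n : ℕ) : x ^ (-(n : ℤ) - 1) = x⁻¹ * x⁻¹ ^ n := by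
  rw [zpow_sub_one₀ hx, zpow_neg, zpow_natCast, inv_pow, mul_comm]

lemma term_negEquiv {q x y z : ℂ} (hx : x ≠ 0) (hy : y ≠ 0) (hz : z ≠ 0) (p : ℕ × ℕ × ℕ) :
    term q x y z (negEquiv p)
      = q ^ 3 / (x * y * z) * natTerm q (q ^ 2 / x) (q ^ 2 / y) (q ^ 2 / z) p := by
  simp only [term, natTerm, negEquiv, Equiv.coe_fn_mk]
  have e : (-(p.1 : ℤ) - 1) * (-(p.2.1 : ℤ) - 1) + (-(p.1 : ℤ) - 1) * (-(p.2.2 : ℤ) - 1)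
      + (-(p.2.1 : ℤ) - 1) * (-(p.2.2 : ℤ) - 1)
      = ((p.1 * p.2.1 + p.1 * p.2.2 + p.2.1 * p.2.2 + 2 * p.1 + 2 * p.2.1 + 2 * p.2.2 + 3 : ℕ) : ℤ)
      := by push_cast; ring
  rw [e, zpow_natCast, zpow_neg_sub_one hx, zpow_neg_sub_one hy, zpow_neg_sub_one hz]
  simp only [div_eq_mul_inv, mul_pow, ← pow_mul, pow_add, mul_inv]
  ring

lemma tripleSum_eq_natSum (q : ℂ) {x y z : ℂ} (hx : x ≠ 0) (hy : y ≠ 0) (hz : z ≠ 0) :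
    tripleSum q x y z = natSum q x y z
      + q ^ 3 / (x * y * z) * natSum q (q ^ 2 / x) (q ^ 2 / y) (q ^ 2 / z) := by
  rw [tripleSum, ← nonnegEquiv.tsum_eq, ← negEquiv.tsum_eq, natSum, natSum, ← tsum_mul_left,
    tsum_congr (term_nonnegEquiv q x y z), tsum_congr (term_negEquiv hx hy hz)]

lemma continuousAt_natSum (hq : ‖q‖ < 1) {x y z : ℂ} (hx : ‖x‖ < 1) (hy : ‖y‖ < 1)
    (hz : ‖z‖ < 1) : ContinuousAt (fun p : ℂ × ℂ × ℂ ↦ natSum q p.1 p.2.1 p.2.2) (x, y, z) := by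
  obtain ⟨a, hxa, ha⟩ := exists_between hx
  obtain ⟨b, hyb, hb⟩ := exists_between hy
  obtain ⟨c, hzc, hc⟩ := exists_between hz
  set U : Set (ℂ × ℂ × ℂ) := Metric.ball 0 a ×ˢ (Metric.ball 0 b ×ˢ Metric.ball 0 c) with hU
  have hUo : IsOpen U := Metric.isOpen_ball.prod (Metric.isOpen_ball.prod Metric.isOpen_ball)
  have hc' : ContinuousOn (fun p : ℂ × ℂ × ℂ ↦ natSum q p.1 p.2.1 p.2.2) U := by
    refine continuousOn_tsum (fun i ↦ ?_) (summable_pow_mul_pow_mul_pow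
      ((norm_nonneg x).trans hxa.le) ha ((norm_nonneg y).trans hyb.le) hb
      ((norm_nonneg z).trans hzc.le) hc) fun i p hp ↦ ?_
    · unfold natTerm
      fun_prop
    · simp only [hU, Set.mem_prod, Metric.mem_ball, dist_zero_right] at hp
      exact norm_natTerm_le hq hp.1.le hp.2.1.le hp.2.2.le i
  exact hc'.continuousAt (hUo.mem_nhds (by simpa [hU] using ⟨hxa, hyb, hzc⟩))

/-- The theta quotient in the Appell–Lerch expression, up to the factors `j(·; q)`. -/
def thetaQuot (q x y z : ℂ) : ℂ :=
  j (x * y) (q ^ 2) * j (x * z) (q ^ 2) * j (y * z) (q ^ 2)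
    / (j (-x) (q ^ 2) * j (-y) (q ^ 2) * j (-z) (q ^ 2))

/-- The difference of the two sides of the identity, multiplied by `j(x;q) j(y;q) j(z;q)`. -/
def defect (q x y z : ℂ) : ℂ :=
  j x q * j y q * j z q * heckeSum q x y z
  - J 1 q ^ 4 / J 2 q ^ 2 * (j x q * (j (y * z) (q ^ 2) * appell q x (y * z))
    + j y q * (j (x * z) (q ^ 2) * appell q y (x * z))
    + j z q * (j (x * y) (q ^ 2) * appell q z (x * y)))
  + 2 * (J 1 q ^ 3 * J 2 q ^ 3) * thetaQuot q x y z

lemma mul_theta_eq (hq : ‖q‖ < 1) (hq0 : q ≠ 0) {w : ℂ} (hw : w ≠ 0) :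
    J 1 q ^ 4 / J 2 q ^ 2 * (j w (q ^ 2) * theta q w) = J 1 q ^ 3 * j w q := by
  have h := j_eq_mul_sq hq hq0 w
  have hJ : J 2 q ≠ 0 := J_ne_zero hq two_ne_zero
  rw [theta_eq_j hq hq0 hw]
  field_simp
  linear_combination -J 1 q ^ 3 * h

lemma j_mul_appell_sq_mul (hq : ‖q‖ < 1) (hq0 : q ≠ 0) {x w : ℂ} (h1 : ‖q‖ ^ 2 < ‖x‖)
    (h2 : ‖x‖ < 1) (hw : w ≠ 0) :
    j (q ^ 2 * w) (q ^ 2) * appell q x (q ^ 2 * w)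
      = -(x * w)⁻¹ * (j w (q ^ 2) * theta q w - j w (q ^ 2) * appell q x w) := by
  have hx0 : x ≠ 0 := norm_pos_iff.mp ((sq_nonneg _).trans_lt h1)
  have hq1 : ‖q‖ ^ 2 < 1 := pow_lt_one₀ (norm_nonneg _) hq two_ne_zero
  have h := appell_sq_mul_right hq hq0 h1 (by nlinarith [norm_nonneg x, sq_nonneg ‖q‖])
    (by rintro rfl; simp at h2) w
  have h' : appell q x (q ^ 2 * w) = x⁻¹ * (theta q w - appell q x w) := by
    rw [← h]; field_simp
  rw [j_mul (norm_pow_lt_one hq two_ne_zero) (pow_ne_zero 2 hq0) hw, h', mul_inv]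
  ring

lemma thetaQuot_sq_mul (hq : ‖q‖ < 1) (hq0 : q ≠ 0) {x y z : ℂ} (hx : x ≠ 0) (hy : y ≠ 0)
    (hz : z ≠ 0) : thetaQuot q x y (q ^ 2 * z) = (x * y * z)⁻¹ * thetaQuot q x y z := by
  have hq2 := norm_pow_lt_one hq two_ne_zero
  have hq20 := pow_ne_zero 2 hq0
  rw [thetaQuot, thetaQuot, show x * (q ^ 2 * z) = q ^ 2 * (x * z) by ring,
    show y * (q ^ 2 * z) = q ^ 2 * (y * z) by ring, show -(q ^ 2 * z) = q ^ 2 * -z by ring,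
    j_mul hq2 hq20 (mul_ne_zero hx hz), j_mul hq2 hq20 (mul_ne_zero hy hz),
    j_mul hq2 hq20 (neg_ne_zero.mpr hz)]
  field_simp

lemma defect_sq_mul (hq : ‖q‖ < 1) (hq0 : q ≠ 0) {x y z : ℂ} (hx1 : ‖q‖ < ‖x‖)
    (hx2 : ‖x‖ < 1) (hy1 : ‖q‖ < ‖y‖) (hy2 : ‖y‖ < 1) (hz1 : 1 < ‖z‖) (hz2 : ‖q‖ * ‖z‖ < 1) :
    defect q x y (q ^ 2 * z) = (x * y)⁻¹ * z⁻¹ * defect q x y z := by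
  have hq' : 0 < ‖q‖ := norm_pos_iff.mpr hq0
  have hx : x ≠ 0 := norm_pos_iff.mp (hq'.trans hx1)
  have hy : y ≠ 0 := norm_pos_iff.mp (hq'.trans hy1)
  have hz : z ≠ 0 := norm_pos_iff.mp (zero_lt_one.trans hz1)
  have hz' : z ≠ 1 := by rintro rfl; simp at hz1
  have hx1' : ‖q‖ ^ 2 < ‖x‖ := by nlinarith
  have hy1' : ‖q‖ ^ 2 < ‖y‖ := by nlinarith
  have eF := heckeSum_sq_mul hq hq0 hx1 hx2 hy1 hy2 hz1 hz2
  have kxy := kronecker_eq hq hq0 hx1 hx2 hy1 (by nlinarith) (by rintro rfl; simp at hy2)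
  have kyz := kronecker_eq hq hq0 hy1 hy2 (hq.trans hz1) hz2 hz'
  have kxz := kronecker_eq hq hq0 hx1 hx2 (hq.trans hz1) hz2 hz'
  have txy := mul_theta_eq hq hq0 (mul_ne_zero hx hy)
  have tyz := mul_theta_eq hq hq0 (mul_ne_zero hy hz)
  have txz := mul_theta_eq hq hq0 (mul_ne_zero hx hz)
  have ax := j_mul_appell_sq_mul hq hq0 hx1' hx2 (mul_ne_zero hy hz)
  have ay := j_mul_appell_sq_mul hq hq0 hy1' hy2 (mul_ne_zero hx hz)
  have az := appell_sq_mul_left hq hq0 (x := z) (w := x * y) (by nlinarith) (by nlinarith)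
    (by rintro rfl; simp at hz1) (mul_ne_zero hx hy)
  have ez := j_sq_mul hq hq0 hz
  have eT := thetaQuot_sq_mul hq hq0 hx hy hz
  have e1 : x * (q ^ 2 * z) = q ^ 2 * (x * z) := by ring
  have e2 : y * (q ^ 2 * z) = q ^ 2 * (y * z) := by ring
  have e3 : y * (x * z) = x * (y * z) := by ring
  have e4 : (x * y)⁻¹ * z⁻¹ = (x * (y * z))⁻¹ := by rw [← mul_inv, mul_assoc]
  have e5 : q⁻¹ * (z ^ 2)⁻¹ * (q * z / (x * y)) = (x * (y * z))⁻¹ := by field_simp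
  rw [defect, defect, e1, e2, eF, ax, ay, az, ez, eT, e3, e4, mul_assoc x y z]
  generalize q⁻¹ * (z ^ 2)⁻¹ = u at *
  generalize q * z / (x * y) = v at *
  generalize (x * (y * z))⁻¹ = t at *
  linear_combination (u * j z q) * (kxy - txy) - t * j x q * (kyz - tyz) - t * j y q * (kxz - txz)
    + (j x q * j y q * j z q * (heckeSum q x y z - kronecker q y z - kronecker q x z)
      - J 1 q ^ 4 / J 2 q ^ 2 * j z q * j (x * y) (q ^ 2) * appell q z (x * y)) * e5

lemma jReg_ne_zero (hq : ‖q‖ < 1) {x : ℂ} (h1 : ‖q‖ < ‖x‖) (h2 : ‖q‖ * ‖x‖ < 1) :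
    jReg x q ≠ 0 :=
  mul_ne_zero (mul_ne_zero (qPoch_ne_zero_of_norm_lt hq (by rwa [norm_mul]))
    (qPoch_ne_zero_of_norm_lt hq (norm_div_lt_one h1))) (qPoch_ne_zero_of_norm_lt hq hq)

/-- The part of `defect` that contributes to the pole at `z = -1`, multiplied by `1 + z`. -/
def polarPart (q x y z : ℂ) : ℂ :=
  2 * (J 1 q ^ 3 * J 2 q ^ 3) * (j (x * y) (q ^ 2) * j (x * z) (q ^ 2) * j (y * z) (q ^ 2)
    / (j (-x) (q ^ 2) * j (-y) (q ^ 2) * jReg (-z) (q ^ 2)))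
  - J 1 q ^ 4 / J 2 q ^ 2 * (j z q * j (x * y) (q ^ 2))

/-- The part of `defect` that is regular at `z = -1`, with its singularity at `z = 1` removed. -/
def regularPart (q x y z : ℂ) : ℂ :=
  j x q * j y q * (jReg z q + j z q * (doubleSumReg q x y z
    + q ^ 3 / (x * y * z) * doubleSum q (q ^ 2 / x) (q ^ 2 / y) (q ^ 2 / z)))
  - J 1 q ^ 4 / J 2 q ^ 2 * (j x q * (j (y * z) (q ^ 2) * appell q x (y * z))
    + j y q * (j (x * z) (q ^ 2) * appell q y (x * z))
    + j z q * (j (x * y) (q ^ 2) * appellReg q z (x * y)))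

lemma defect_eq_regularPart_add (hq : ‖q‖ < 1) (hq0 : q ≠ 0) {x y z : ℂ} (hx : ‖x‖ < 1)
    (hy : ‖y‖ < 1) (hz1 : ‖q‖ ^ 2 < ‖z‖) (hz2 : ‖q‖ * ‖z‖ < 1) (h1 : z ≠ 1) (h2 : z ≠ -1) :
    defect q x y z = regularPart q x y z + polarPart q x y z / (1 + z) := by
  have h1' : 1 - z ≠ 0 := sub_ne_zero.mpr h1.symm
  have h2' : 1 + z ≠ 0 := fun h ↦ h2 (by linear_combination h)
  have ha := appell_eq_add_appellReg hq hq0 hz1 (by nlinarith [norm_nonneg q, norm_nonneg z])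
    (x * y)
  have hj := j_eq_mul_jReg hq z
  have hT : thetaQuot q x y z = j (x * y) (q ^ 2) * j (x * z) (q ^ 2) * j (y * z) (q ^ 2)
      / (j (-x) (q ^ 2) * j (-y) (q ^ 2) * jReg (-z) (q ^ 2)) / (1 + z) := by
    rw [thetaQuot, j_eq_mul_jReg (norm_pow_lt_one hq two_ne_zero) (-z), div_div]
    congr 1
    ring
  have hP : j z q * (1 / (1 - z)) = jReg z q := by rw [hj]; field_simp
  rw [defect, regularPart, polarPart, heckeSum, doubleSum_eq_add_doubleSumReg hq hx hy, ha, hT]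
  linear_combination j x q * j y q * hP

lemma polarPart_neg_one (hq : ‖q‖ < 1) {x y : ℂ} (hx1 : ‖q ^ 2‖ < ‖x‖) (hx2 : ‖x‖ < 1)
    (hy1 : ‖q ^ 2‖ < ‖y‖) (hy2 : ‖y‖ < 1) : polarPart q x y (-1) = 0 := by
  have hq2 := norm_pow_lt_one hq two_ne_zero
  have h1 : j (-x) (q ^ 2) ≠ 0 := j_ne_zero hq2 (by rwa [norm_neg]) (by rwa [norm_neg])
  have h2 : j (-y) (q ^ 2) ≠ 0 := j_ne_zero hq2 (by rwa [norm_neg]) (by rwa [norm_neg])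
  have hJ : J 2 q ≠ 0 := J_ne_zero hq two_ne_zero
  have h := j_neg_one hq
  have hR : jReg 1 (q ^ 2) = J 2 q ^ 3 := by rw [jReg_one, J]
  rw [polarPart, neg_neg, hR, mul_neg_one, mul_neg_one]
  field_simp
  linear_combination -j (x * y) (q ^ 2) * J 1 q ^ 3 * h

lemma differentiableAt_regularPart (hq : ‖q‖ < 1) (hq0 : q ≠ 0) {x y z : ℂ}
    (hx1 : ‖q ^ 2‖ < ‖x‖) (hx2 : ‖x‖ < 1) (hy1 : ‖q ^ 2‖ < ‖y‖) (hy2 : ‖y‖ < 1)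
    (hz1 : ‖q ^ 2‖ < ‖z‖) (hz2 : ‖q‖ * ‖z‖ < 1) :
    DifferentiableAt ℂ (fun z ↦ regularPart q x y z) z := by
  have hq2 := norm_pow_lt_one hq two_ne_zero
  have hx : x ≠ 0 := norm_pos_iff.mp ((norm_nonneg _).trans_lt hx1)
  have hy : y ≠ 0 := norm_pos_iff.mp ((norm_nonneg _).trans_lt hy1)
  have hz : z ≠ 0 := norm_pos_iff.mp ((norm_nonneg _).trans_lt hz1)
  have hqz := norm_div_lt_one hz1
  have hlt : ∀ w : ℂ, ‖w‖ < 1 → ‖q‖ ^ 2 * ‖w‖ < 1 := fun w hw ↦ by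
    rw [norm_pow] at hq2; nlinarith [norm_nonneg w, sq_nonneg ‖q‖]
  have d1 : DifferentiableAt ℂ (fun z ↦ doubleSum q (q ^ 2 / x) (q ^ 2 / y) (q ^ 2 / z)) z := by
    refine DifferentiableAt.comp z (f := fun z ↦ q ^ 2 / z)
      (differentiableAt_doubleSum hq (norm_div_lt_one hx1) (norm_div_lt_one hy1)
        (z := q ^ 2 / z) ?_ ?_) (by fun_prop (disch := exact hz))
    · nlinarith [norm_nonneg (q ^ 2 / z), norm_nonneg q]
    · intro h; rw [h, norm_one] at hqz; exact lt_irrefl _ hqz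
  have d2 : DifferentiableAt ℂ (fun z ↦ q ^ 3 / (x * y * z)) z := by
    have : x * y * z ≠ 0 := mul_ne_zero (mul_ne_zero hx hy) hz
    fun_prop (disch := exact this)
  have d3 : ∀ {c : ℂ}, c ≠ 0 → DifferentiableAt ℂ (fun z ↦ j (c * z) (q ^ 2)) z := fun hc ↦
    differentiableAt_j_comp hq2 (f := fun z ↦ _ * z) (by fun_prop) (mul_ne_zero hc hz)
  have d4 : ∀ {a c : ℂ}, ‖q ^ 2‖ < ‖a‖ → ‖a‖ < 1 → c ≠ 0 →
      DifferentiableAt ℂ (fun z ↦ appell q a (c * z)) z := fun ha1 ha2 hc ↦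
    DifferentiableAt.comp z (f := fun z ↦ _ * z)
      (differentiableAt_appell_right hq hq0 (by rwa [← norm_pow]) (hlt _ ha2)
        (mul_ne_zero hc hz)) (by fun_prop)
  have d5 := differentiableAt_appellReg hq hq0 (x := z) (by rwa [← norm_pow])
    (by nlinarith [norm_nonneg q, norm_nonneg z]) (x * y)
  have d6 := differentiableAt_j hq hz
  unfold regularPart
  exact (((differentiableAt_jReg hq hz).add (d6.mul
    ((differentiableAt_doubleSumReg hq hx2 hy2 hz2).add (d2.mul d1)))).const_mul _).sub
    (((((d3 hy).mul (d4 hx1 hx2 hy)).const_mul _).add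
      (((d3 hx).mul (d4 hy1 hy2 hx)).const_mul _)).add (d6.mul (d5.const_mul _)) |>.const_mul _)

lemma differentiableAt_polarPart (hq : ‖q‖ < 1) {x y z : ℂ}
    (hx1 : ‖q ^ 2‖ < ‖x‖) (hx2 : ‖x‖ < 1) (hy1 : ‖q ^ 2‖ < ‖y‖) (hy2 : ‖y‖ < 1)
    (hz1 : ‖q ^ 2‖ < ‖z‖) (hz2 : ‖q‖ * ‖z‖ < 1) :
    DifferentiableAt ℂ (fun z ↦ polarPart q x y z) z := by
  have hq2 := norm_pow_lt_one hq two_ne_zero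
  have hx : x ≠ 0 := norm_pos_iff.mp ((norm_nonneg _).trans_lt hx1)
  have hy : y ≠ 0 := norm_pos_iff.mp ((norm_nonneg _).trans_lt hy1)
  have hz : z ≠ 0 := norm_pos_iff.mp ((norm_nonneg _).trans_lt hz1)
  have h1 : j (-x) (q ^ 2) ≠ 0 := j_ne_zero hq2 (by rwa [norm_neg]) (by rwa [norm_neg])
  have h2 : j (-y) (q ^ 2) ≠ 0 := j_ne_zero hq2 (by rwa [norm_neg]) (by rwa [norm_neg])
  have h3 : jReg (-z) (q ^ 2) ≠ 0 := by
    refine jReg_ne_zero hq2 (by rwa [norm_neg]) ?_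
    rw [norm_neg, norm_pow]
    nlinarith [norm_nonneg q, norm_nonneg z]
  have d3 : ∀ {c : ℂ}, c ≠ 0 → DifferentiableAt ℂ (fun z ↦ j (c * z) (q ^ 2)) z := fun hc ↦
    differentiableAt_j_comp hq2 (f := fun z ↦ _ * z) (by fun_prop) (mul_ne_zero hc hz)
  have d4 : DifferentiableAt ℂ (fun z ↦ jReg (-z) (q ^ 2)) z :=
    DifferentiableAt.comp z (f := fun z ↦ -z) (differentiableAt_jReg hq2 (neg_ne_zero.mpr hz))
      (by fun_prop)
  unfold polarPart
  exact (((((d3 hx).const_mul _).mul (d3 hy)).div (d4.const_mul _)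
    (mul_ne_zero (mul_ne_zero h1 h2) h3)).const_mul _).sub
    (((differentiableAt_j hq hz).mul_const _).const_mul _)

/-- In each variable, `defect` is proportional to `j(-xyz; q²)`. -/
lemma defect_mul_eq (hq : ‖q‖ < 1) (hq0 : q ≠ 0) {x y z w : ℂ} (hx1 : ‖q‖ < ‖x‖)
    (hx2 : ‖x‖ < 1) (hy1 : ‖q‖ < ‖y‖) (hy2 : ‖y‖ < 1) (hz1 : ‖q ^ 2‖ < ‖z‖) (hz2 : ‖z‖ < 1)
    (hw1 : ‖q ^ 2‖ < ‖w‖) (hw2 : ‖w‖ < 1) :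
    defect q x y z * j (-(x * y) * w) (q ^ 2) = defect q x y w * j (-(x * y) * z) (q ^ 2) := by
  have hq' : 0 < ‖q‖ := norm_pos_iff.mpr hq0
  have hq2 := norm_pow_lt_one hq two_ne_zero
  have hq20 := pow_ne_zero 2 hq0
  have hx : x ≠ 0 := norm_pos_iff.mp (hq'.trans hx1)
  have hy : y ≠ 0 := norm_pos_iff.mp (hq'.trans hy1)
  have hxy : -(x * y) ≠ 0 := neg_ne_zero.mpr (mul_ne_zero hx hy)
  have hx1' := norm_sq_lt hq hx1
  have hy1' := norm_sq_lt hq hy1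
  have hinv : 1 < ‖q‖⁻¹ := (one_lt_inv₀ hq').mpr hq
  have hmem : ∀ u : ℂ, u ∈ annulus ‖q ^ 2‖ ‖q‖⁻¹ ↔ ‖q ^ 2‖ < ‖u‖ ∧ ‖q‖ * ‖u‖ < 1 := fun u ↦ by
    rw [annulus, Set.mem_ofPred_eq, ← one_div, lt_div_iff₀ hq', mul_comm ‖u‖]
  set f : ℂ → ℂ := fun z ↦ regularPart q x y z + dslope (polarPart q x y) (-1) z with hf
  have hfeq : ∀ u : ℂ, ‖q ^ 2‖ < ‖u‖ → ‖q‖ * ‖u‖ < 1 → u ≠ 1 → u ≠ -1 →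
      f u = defect q x y u := by
    intro u hu1 hu2 hu3 hu4
    rw [defect_eq_regularPart_add hq hq0 hx2 hy2 (by rwa [← norm_pow]) hu2 hu3 hu4]
    simp only [hf]
    rw [dslope_of_ne _ hu4, slope_def_field, polarPart_neg_one hq hx1' hx2 hy1' hy2, sub_zero,
      sub_neg_eq_add, add_comm u]
  have hfd : DifferentiableOn ℂ f (annulus ‖q ^ 2‖ ‖q‖⁻¹) := by
    refine DifferentiableOn.add (fun u hu ↦ ?_) ?_
    · obtain ⟨hu1, hu2⟩ := (hmem u).mp hu
      exact (differentiableAt_regularPart hq hq0 hx1' hx2 hy1' hy2 hu1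
        hu2).differentiableWithinAt
    · rw [Complex.differentiableOn_dslope]
      · intro u hu
        obtain ⟨hu1, hu2⟩ := (hmem u).mp hu
        exact (differentiableAt_polarPart hq hx1' hx2 hy1' hy2 hu1 hu2).differentiableWithinAt
      · refine (isOpen_annulus _ _).mem_nhds ((hmem _).mpr ⟨?_, ?_⟩) <;>
          rw [norm_neg, norm_one]
        · exact hq2
        · simpa using hq
  obtain ⟨r, hr1, hr2⟩ := exists_between hinv
  have hqr : ‖q‖ * r < 1 := by
    have := mul_lt_mul_of_pos_left hr2 hq'
    rwa [mul_inv_cancel₀ hq'.ne'] at this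
  have hgt : ∀ u : ℂ, ‖u‖ ≠ 1 → u ≠ 1 ∧ u ≠ -1 := fun u hu ↦
    ⟨by rintro rfl; simp at hu, by rintro rfl; simp at hu⟩
  have hcross := mul_eq_mul_of_quasiPeriodic (norm_nonneg (q ^ 2)) hq20 hq2 (c := (x * y)⁻¹)
    (inv_ne_zero (mul_ne_zero hx hy)) hfd (g := fun z ↦ j (-(x * y) * z) (q ^ 2)) (r := r)
    (fun u hu ↦ (differentiableAt_j_comp hq2 (f := fun z ↦ -(x * y) * z) (by fun_prop)
      (mul_ne_zero hxy (norm_pos_iff.mp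
        ((norm_nonneg _).trans_lt hu.1)))).differentiableWithinAt)
    (by have := norm_pos_iff.mpr hq20; nlinarith) hr2
    (fun u hu ↦ by
      have hn : ‖q ^ 2 * u‖ = ‖q ^ 2‖ * r := by rw [norm_mul, hu]
      have hlt : ‖q ^ 2‖ * r < 1 := by
        rw [norm_pow]; nlinarith
      have h1 := hgt u (by rw [hu]; exact hr1.ne')
      have h2 := hgt (q ^ 2 * u) (by rw [hn]; exact hlt.ne)
      have hu1 : 1 < ‖u‖ := by rwa [hu]
      have hu2 : ‖q‖ * ‖u‖ < 1 := by rwa [hu]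
      rw [hfeq u (hq2.trans hu1) hu2 h1.1 h1.2, hfeq (q ^ 2 * u)
        (by rw [hn]; have := norm_pos_iff.mpr hq20; nlinarith) (by rw [hn]; nlinarith) h2.1 h2.2,
        defect_sq_mul hq hq0 hx1 hx2 hy1 hy2 hu1 hu2])
    (fun u hu ↦ by
      have hu0 : u ≠ 0 := norm_pos_iff.mp (by rw [hu]; linarith)
      rw [show -(x * y) * (q ^ 2 * u) = q ^ 2 * (-(x * y) * u) by ring,
        j_mul hq2 hq20 (mul_ne_zero hxy hu0), mul_inv, inv_neg]
      ring)
    ((hmem z).mpr ⟨hz1, by nlinarith [norm_nonneg z]⟩)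
    ((hmem w).mpr ⟨hw1, by nlinarith [norm_nonneg w]⟩)
  have hz' := hgt z hz2.ne
  have hw' := hgt w hw2.ne
  rwa [hfeq z hz1 (by nlinarith [norm_nonneg z]) hz'.1 hz'.2,
    hfeq w hw1 (by nlinarith [norm_nonneg w]) hw'.1 hw'.2] at hcross

lemma defect_swap_left (q x y z : ℂ) : defect q x y z = defect q y x z := by
  rw [defect, defect, thetaQuot, thetaQuot, heckeSum_comm q x y, mul_comm x y]
  ring

lemma defect_swap_right (hq : ‖q‖ < 1) {x y z : ℂ} (hx1 : ‖q ^ 2‖ < ‖x‖) (hx2 : ‖x‖ < 1)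
    (hy1 : ‖q ^ 2‖ < ‖y‖) (hy2 : ‖y‖ < 1) (hz1 : ‖q ^ 2‖ < ‖z‖) (hz2 : ‖z‖ < 1) :
    defect q x y z = defect q x z y := by
  have h : heckeSum q x y z = heckeSum q x z y := by
    rw [heckeSum_eq_natSum hq hx2 hy2 hz2 hx1 hy1 hz1, heckeSum_eq_natSum hq hx2 hz2 hy2 hx1 hz1 hy1,
      natSum_comm q x y z, natSum_comm q (q ^ 2 / x) (q ^ 2 / y), mul_right_comm x y z]
  rw [defect, defect, thetaQuot, thetaQuot, h, mul_comm y z]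
  ring

lemma continuousAt_defect (hq : ‖q‖ < 1) (hq0 : q ≠ 0) {x y z : ℂ} (hx1 : ‖q ^ 2‖ < ‖x‖)
    (hx2 : ‖x‖ < 1) (hy1 : ‖q ^ 2‖ < ‖y‖) (hy2 : ‖y‖ < 1) (hz1 : ‖q ^ 2‖ < ‖z‖)
    (hz2 : ‖z‖ < 1) : ContinuousAt (fun z ↦ defect q x y z) z := by
  have hlt : ∀ u : ℂ, ‖u‖ < 1 → ‖q‖ * ‖u‖ < 1 := fun u hu ↦ by
    nlinarith [norm_nonneg u, norm_nonneg q]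
  have hne : ∀ u : ℂ, ‖u‖ < 1 → u ≠ 1 ∧ u ≠ -1 := fun u hu ↦
    ⟨by rintro rfl; simp at hu, by rintro rfl; simp at hu⟩
  have h0 : 1 + z ≠ 0 := fun h ↦ (hne z hz2).2 (by linear_combination h)
  have hd : DifferentiableAt ℂ (fun z ↦ regularPart q x y z + polarPart q x y z / (1 + z)) z :=
    (differentiableAt_regularPart hq hq0 hx1 hx2 hy1 hy2 hz1 (hlt z hz2)).add
      ((differentiableAt_polarPart hq hx1 hx2 hy1 hy2 hz1 (hlt z hz2)).div (by fun_prop) h0)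
  refine hd.continuousAt.congr ?_
  filter_upwards [(isOpen_annulus ‖q ^ 2‖ 1).mem_nhds ⟨hz1, hz2⟩] with u hu
  exact (defect_eq_regularPart_add hq hq0 hx2 hy2 (by rw [← norm_pow]; exact hu.1) (hlt u hu.2)
    (hne u hu.2).1 (hne u hu.2).2).symm

lemma defect_self_self (hq : ‖q‖ < 1) (hq0 : q ≠ 0) (x : ℂ) : defect q x q q = 0 := by
  have h := j_self (norm_pow_lt_one hq two_ne_zero) (pow_ne_zero 2 hq0)
  rw [defect, thetaQuot, j_self hq hq0, ← pow_two, h]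
  ring

/-- `j(qw; q²)` vanishes on `‖q‖² < ‖w‖ < 1` only at `w = q`. -/
lemma j_mul_sq_ne_zero (hq : ‖q‖ < 1) (hq0 : q ≠ 0) {w : ℂ} (h1 : ‖q ^ 2‖ < ‖w‖) (h2 : ‖w‖ < 1)
    (hw : w ≠ q) : j (q * w) (q ^ 2) ≠ 0 := by
  have hq' : 0 < ‖q‖ := norm_pos_iff.mpr hq0
  have hq2 := norm_pow_lt_one hq two_ne_zero
  have hw0 : w ≠ 0 := norm_pos_iff.mp ((norm_nonneg _).trans_lt h1)
  have hv : w / q ≠ 0 := div_ne_zero hw0 hq0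
  rw [show q * w = q ^ 2 * (w / q) by field_simp, j_mul hq2 (pow_ne_zero 2 hq0) hv,
    j_eq_mul_jReg hq2]
  refine mul_ne_zero (neg_ne_zero.mpr (inv_ne_zero hv)) (mul_ne_zero ?_ (jReg_ne_zero hq2 ?_ ?_))
  · rw [sub_ne_zero]
    intro h
    exact hw ((div_eq_one_iff_eq hq0).mp h.symm)
  · rw [norm_div, lt_div_iff₀ hq']
    nlinarith [norm_nonneg (q ^ 2)]
  · rw [norm_div, norm_pow, ← mul_div_assoc, div_lt_one hq']
    nlinarith [norm_nonneg w]

lemma defect_self_right (hq : ‖q‖ < 1) (hq0 : q ≠ 0) {x y : ℂ} (hx1 : ‖q‖ < ‖x‖)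
    (hx2 : ‖x‖ < 1) (hy1 : ‖q‖ < ‖y‖) (hy2 : ‖y‖ < 1) : defect q x y q = 0 := by
  have hq' : 0 < ‖q‖ := norm_pos_iff.mpr hq0
  have hq2 := norm_pow_lt_one hq two_ne_zero
  have hy : y ≠ 0 := norm_pos_iff.mp (hq'.trans hy1)
  have hx : x ≠ 0 := norm_pos_iff.mp (hq'.trans hx1)
  have hx1' := norm_sq_lt hq hx1
  have hy1' := norm_sq_lt hq hy1
  have hqq : ‖q ^ 2‖ < ‖q‖ := by rw [norm_pow]; nlinarith
  set p : ℝ → ℂ := fun t ↦ t * q with hp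
  have hpc : Tendsto p (𝓝[>] 1) (𝓝 q) := by
    have : Continuous p := by fun_prop
    simpa [hp] using (this.tendsto 1).mono_left nhdsWithin_le_nhds
  have hpmem : ∀ᶠ t in 𝓝[>] (1 : ℝ), ‖q‖ < ‖p t‖ ∧ ‖p t‖ < 1 := by
    refine Filter.Eventually.and ?_ ?_
    · filter_upwards [self_mem_nhdsWithin] with t ht
      have ht' : 1 < t := ht
      simp only [hp]
      rw [norm_mul, Complex.norm_real, Real.norm_of_nonneg (by linarith)]
      nlinarith
    · exact hpc.norm.eventually_lt_const hq
  have hcross : ∀ᶠ t in 𝓝[>] (1 : ℝ), defect q x y (p t) * j (-(y * p t) * q) (q ^ 2)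
      = defect q y q (p t) * j (-(y * p t) * x) (q ^ 2) := by
    filter_upwards [hpmem] with t ht
    have ht' := norm_sq_lt hq ht.1
    have := defect_mul_eq hq hq0 hy1 hy2 ht.1 ht.2 hx1' hx2 hqq hq
    rwa [defect_swap_right hq hy1' hy2 ht' ht.2 hx1' hx2, defect_swap_left q y x,
      defect_swap_right hq hy1' hy2 ht' ht.2 hqq hq] at this
  have hjc : ∀ {c : ℂ}, c ≠ 0 → Tendsto (fun t ↦ j (-(y * p t) * c) (q ^ 2)) (𝓝[>] 1)
      (𝓝 (j (-(y * q) * c) (q ^ 2))) := by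
    intro c hc
    have h1 : ContinuousAt (fun u ↦ j (-(y * u) * c) (q ^ 2)) q :=
      (differentiableAt_j_comp hq2 (f := fun u ↦ -(y * u) * c) (by fun_prop)
        (mul_ne_zero (neg_ne_zero.mpr (mul_ne_zero hy hq0)) hc)).continuousAt
    exact h1.tendsto.comp hpc
  have l1 := ((continuousAt_defect hq hq0 hx1' hx2 hy1' hy2 hqq hq).tendsto.comp hpc).mul
    (hjc hq0)
  have l2 := ((continuousAt_defect hq hq0 hy1' hy2 hqq hq hqq hq).tendsto.comp hpc).mul
    (hjc hx)
  rw [defect_self_self hq hq0, zero_mul] at l2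
  have h := tendsto_nhds_unique_of_eventuallyEq l1 l2 hcross
  refine (mul_eq_zero.mp h).resolve_right ?_
  rw [show -(y * q) * q = q ^ 2 * -y by ring, j_mul hq2 (pow_ne_zero 2 hq0) (neg_ne_zero.mpr hy)]
  exact mul_ne_zero (neg_ne_zero.mpr (inv_ne_zero (neg_ne_zero.mpr hy)))
    (j_ne_zero hq2 (by rwa [norm_neg]) (by rwa [norm_neg]))

lemma norm_mul_mem {x y : ℂ} (hx1 : ‖q‖ < ‖x‖) (hx2 : ‖x‖ < 1) (hy1 : ‖q‖ < ‖y‖)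
    (hy2 : ‖y‖ < 1) : ‖q ^ 2‖ < ‖x * y‖ ∧ ‖x * y‖ < 1 := by
  rw [norm_pow, norm_mul]
  constructor <;> nlinarith [norm_nonneg q]

lemma defect_eq_zero_of_ne (hq : ‖q‖ < 1) (hq0 : q ≠ 0) {x y z : ℂ} (hx1 : ‖q‖ < ‖x‖)
    (hx2 : ‖x‖ < 1) (hy1 : ‖q‖ < ‖y‖) (hy2 : ‖y‖ < 1) (hz1 : ‖q‖ < ‖z‖) (hz2 : ‖z‖ < 1)
    (hxy : x * y ≠ -q) : defect q x y z = 0 := by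
  have hq' : 0 < ‖q‖ := norm_pos_iff.mpr hq0
  have h := defect_mul_eq hq hq0 hx1 hx2 hy1 hy2 (norm_sq_lt hq hz1) hz2
    (w := q) (by rw [norm_pow]; nlinarith) hq
  rw [defect_self_right hq hq0 hx1 hx2 hy1 hy2, zero_mul, mul_comm _ q] at h
  obtain ⟨h1, h2⟩ := norm_mul_mem hx1 hx2 hy1 hy2
  refine (mul_eq_zero.mp h).resolve_right (j_mul_sq_ne_zero hq hq0 (by rwa [norm_neg])
    (by rwa [norm_neg]) ?_)
  intro h
  exact hxy (by rw [← h, neg_neg])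

lemma defect_eq_zero (hq : ‖q‖ < 1) (hq0 : q ≠ 0) {x y z : ℂ} (hx1 : ‖q‖ < ‖x‖)
    (hx2 : ‖x‖ < 1) (hy1 : ‖q‖ < ‖y‖) (hy2 : ‖y‖ < 1) (hz1 : ‖q‖ < ‖z‖) (hz2 : ‖z‖ < 1) :
    defect q x y z = 0 := by
  have hx1' := norm_sq_lt hq hx1
  have hy1' := norm_sq_lt hq hy1
  have hx : x ≠ 0 := norm_pos_iff.mp ((norm_nonneg _).trans_lt hx1)
  have hswap : ∀ u : ℂ, ‖q‖ < ‖u‖ → ‖u‖ < 1 → x * u ≠ -q → defect q x y u = 0 := by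
    intro u hu1 hu2 hu
    rw [defect_swap_right hq hx1' hx2 hy1' hy2 (norm_sq_lt hq hu1) hu2]
    exact defect_eq_zero_of_ne hq hq0 hx1 hx2 hu1 hu2 hy1 hy2 hu
  by_cases hxz : x * z = -q
  · have hc := (continuousAt_defect hq hq0 hx1' hx2 hy1' hy2 (norm_sq_lt hq hz1)
      hz2).tendsto.mono_left (nhdsWithin_le_nhds (s := {z}ᶜ))
    refine tendsto_nhds_unique_of_eventuallyEq hc tendsto_const_nhds ?_
    filter_upwards [self_mem_nhdsWithin,
      nhdsWithin_le_nhds ((isOpen_annulus ‖q‖ 1).mem_nhds ⟨hz1, hz2⟩)] with u hu hu'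
    refine hswap u hu'.1 hu'.2 fun h ↦ hu ?_
    exact mul_left_cancel₀ hx (h.trans hxz.symm)
  · exact hswap z hz1 hz2 hxz

lemma m_eq_appell (hq0 : q ≠ 0) (x : ℂ) {y z : ℂ} (hy : y ≠ 0) (hz : z ≠ 0) :
    m (-(q * x / (y * z))) (q ^ 2) (q * y * z)
      = 1 / j (q * (y * z)) (q ^ 2) * appell q x (y * z) := by
  rw [m, appell, mul_assoc q y z]
  congr 1
  refine tsum_congr fun r ↦ ?_
  have e1 : (q ^ 2) ^ (r * (r - 1) / 2) = q ^ (r * (r - 1)) := by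
    rw [← zpow_natCast, ← zpow_mul]
    congr 1
    exact Int.mul_ediv_cancel' (Int.even_mul_pred_self r).two_dvd
  have e2 : (q ^ 2) ^ (r - 1) * (q * q) = q ^ (2 * r) := by
    rw [← zpow_natCast, ← zpow_mul, ← zpow_two, ← zpow_add₀ hq0]
    congr 1
    push_cast
    ring
  have e3 : (-1 : ℂ) ^ r * (q ^ 2) ^ (r * (r - 1) / 2) * (q * (y * z)) ^ r
      = thetaTerm q (y * z) r := by
    rw [thetaTerm, e1, mul_zpow q, show r ^ 2 = r * (r - 1) + r by ring, zpow_add₀ hq0]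
    ring
  have e4 : 1 - (q ^ 2) ^ (r - 1) * -(q * x / (y * z)) * (q * (y * z)) = 1 + q ^ (2 * r) * x := by
    rw [← e2]
    generalize (q ^ 2) ^ (r - 1) = t
    field_simp
    ring
  rw [e3, e4]

/-- The factor `j(w; q)` absorbs the denominator of the Appell–Lerch function. -/
lemma J_mul_j_mul_eq (hq : ‖q‖ < 1) (hq0 : q ≠ 0) {w : ℂ} (h1 : ‖q ^ 2‖ < ‖w‖) (h2 : ‖w‖ < 1)
    (hw : w ≠ q) (A : ℂ) :
    J 1 q ^ 3 * j w q * (1 / j (q * w) (q ^ 2) * A)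
      = J 1 q ^ 4 / J 2 q ^ 2 * (j w (q ^ 2) * A) := by
  have h := j_eq_mul_sq hq hq0 w
  have hne := j_mul_sq_ne_zero hq hq0 h1 h2 hw
  have hJ : J 2 q ≠ 0 := J_ne_zero hq two_ne_zero
  field_simp
  linear_combination J 1 q ^ 3 * A * h

lemma heckeSum_eq_appellLerchSide (hq : ‖q‖ < 1) (hq0 : q ≠ 0) {x y z : ℂ} (hx1 : ‖q‖ < ‖x‖)
    (hx2 : ‖x‖ < 1) (hy1 : ‖q‖ < ‖y‖) (hy2 : ‖y‖ < 1) (hz1 : ‖q‖ < ‖z‖) (hz2 : ‖z‖ < 1)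
    (hxy : x * y ≠ q) (hxz : x * z ≠ q) (hyz : y * z ≠ q) :
    heckeSum q x y z = appellLerchSide q x y z := by
  have hq' : 0 < ‖q‖ := norm_pos_iff.mpr hq0
  have hx : x ≠ 0 := norm_pos_iff.mp (hq'.trans hx1)
  have hy : y ≠ 0 := norm_pos_iff.mp (hq'.trans hy1)
  have hz : z ≠ 0 := norm_pos_iff.mp (hq'.trans hz1)
  have jx := j_ne_zero hq hx1 hx2
  have jy := j_ne_zero hq hy1 hy2
  have jz := j_ne_zero hq hz1 hz2
  have h := defect_eq_zero hq hq0 hx1 hx2 hy1 hy2 hz1 hz2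
  have nxy := norm_mul_mem hx1 hx2 hy1 hy2
  have nxz := norm_mul_mem hx1 hx2 hz1 hz2
  have nyz := norm_mul_mem hy1 hy2 hz1 hz2
  have exy := J_mul_j_mul_eq hq hq0 nxy.1 nxy.2 hxy (appell q z (x * y))
  have exz := J_mul_j_mul_eq hq hq0 nxz.1 nxz.2 hxz (appell q y (x * z))
  have eyz := J_mul_j_mul_eq hq hq0 nyz.1 nyz.2 hyz (appell q x (y * z))
  rw [defect] at h
  rw [appellLerchSide, m_eq_appell hq0 x hy hz, m_eq_appell hq0 z hx hy, m_eq_appell hq0 y hx hz,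
    ← thetaQuot]
  generalize 1 / j (q * (y * z)) (q ^ 2) * appell q x (y * z) = m1 at *
  generalize 1 / j (q * (x * z)) (q ^ 2) * appell q y (x * z) = m2 at *
  generalize 1 / j (q * (x * y)) (q ^ 2) * appell q z (x * y) = m3 at *
  generalize j (x * y) q = a1 at *
  generalize j (x * z) q = a2 at *
  generalize j (y * z) q = a3 at *
  refine mul_left_cancel₀ (mul_ne_zero (mul_ne_zero jx jy) jz) ?_
  field_simp
  linear_combination h - j x q * eyz - j y q * exz - j z q * exy

lemma tripleSum_eq_heckeSum (hq : ‖q‖ < 1) {x y z : ℂ} (hx1 : ‖q‖ < ‖x‖)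
    (hx2 : ‖x‖ < 1) (hy1 : ‖q‖ < ‖y‖) (hy2 : ‖y‖ < 1) (hz1 : ‖q‖ < ‖z‖) (hz2 : ‖z‖ < 1) :
    tripleSum q x y z = heckeSum q x y z := by
  rw [heckeSum_eq_natSum hq hx2 hy2 hz2 (norm_sq_lt hq hx1) (norm_sq_lt hq hy1)
    (norm_sq_lt hq hz1), tripleSum_eq_natSum] <;>
  exact norm_pos_iff.mp ((norm_nonneg q).trans_lt ‹_›)

lemma continuousAt_tripleSum (hq : ‖q‖ < 1) {x y z : ℂ} (hx1 : ‖q‖ < ‖x‖)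
    (hx2 : ‖x‖ < 1) (hy1 : ‖q‖ < ‖y‖) (hy2 : ‖y‖ < 1) (hz1 : ‖q‖ < ‖z‖) (hz2 : ‖z‖ < 1) :
    ContinuousAt (fun p : ℂ × ℂ × ℂ ↦ tripleSum q p.1 p.2.1 p.2.2) (x, y, z) := by
  have hx : x ≠ 0 := norm_pos_iff.mp ((norm_nonneg _).trans_lt hx1)
  have hy : y ≠ 0 := norm_pos_iff.mp ((norm_nonneg _).trans_lt hy1)
  have hz : z ≠ 0 := norm_pos_iff.mp ((norm_nonneg _).trans_lt hz1)
  have c1 : ContinuousAt (fun p : ℂ × ℂ × ℂ ↦ p.1) (x, y, z) := by fun_prop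
  have c2 : ContinuousAt (fun p : ℂ × ℂ × ℂ ↦ p.2.1) (x, y, z) := by fun_prop
  have c3 : ContinuousAt (fun p : ℂ × ℂ × ℂ ↦ p.2.2) (x, y, z) := by fun_prop
  have hinv : ContinuousAt
      (fun p : ℂ × ℂ × ℂ ↦ (q ^ 2 / p.1, q ^ 2 / p.2.1, q ^ 2 / p.2.2)) (x, y, z) :=
    (continuousAt_const.div c1 hx).prodMk
      ((continuousAt_const.div c2 hy).prodMk (continuousAt_const.div c3 hz))
  have h2 : ContinuousAt (fun p : ℂ × ℂ × ℂ ↦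
      natSum q (q ^ 2 / p.1) (q ^ 2 / p.2.1) (q ^ 2 / p.2.2)) (x, y, z) :=
    ContinuousAt.comp (f := fun p : ℂ × ℂ × ℂ ↦ (q ^ 2 / p.1, q ^ 2 / p.2.1, q ^ 2 / p.2.2))
      (g := fun p : ℂ × ℂ × ℂ ↦ natSum q p.1 p.2.1 p.2.2)
      (continuousAt_natSum hq (norm_div_lt_one (norm_sq_lt hq hx1))
        (norm_div_lt_one (norm_sq_lt hq hy1)) (norm_div_lt_one (norm_sq_lt hq hz1))) hinv
  have h3 : ContinuousAt (fun p : ℂ × ℂ × ℂ ↦ q ^ 3 / (p.1 * p.2.1 * p.2.2)) (x, y, z) :=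
    continuousAt_const.div ((c1.mul c2).mul c3) (mul_ne_zero (mul_ne_zero hx hy) hz)
  refine ((continuousAt_natSum hq hx2 hy2 hz2).add (h3.mul h2)).congr ?_
  filter_upwards [c1.eventually_ne hx, c2.eventually_ne hy, c3.eventually_ne hz] with p h1 h2 h3
  exact (tripleSum_eq_natSum q h1 h2 h3).symm

end HeckeTriple

end

open HeckeTriple in
theorem mainTheorem2 (q x y z : ℂ) (hq : q ≠ 0)
    (hqx : ‖q‖ < ‖x‖) (hx : ‖x‖ < 1)
    (hqy : ‖q‖ < ‖y‖) (hy : ‖y‖ < 1)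
    (hqz : ‖q‖ < ‖z‖) (hz : ‖z‖ < 1) :
    -- both triple series converge absolutely
    Summable (fun p : HeckeTriple.nonnegTriples => HeckeTriple.term q x y z p) ∧
    Summable (fun p : HeckeTriple.negTriples => HeckeTriple.term q x y z p) ∧
    -- the identity, wherever its right-hand side is defined
    ((x, y, z) ∈ HeckeTriple.regularPoints q →
      HeckeTriple.tripleSum q x y z = HeckeTriple.appellLerchSide q x y z) ∧
    -- at the removable singularities, the right-hand side is understood as a limit
    Tendsto (fun p : ℂ × ℂ × ℂ => HeckeTriple.appellLerchSide q p.1 p.2.1 p.2.2)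
      (𝓝[HeckeTriple.regularPoints q] (x, y, z)) (𝓝 (HeckeTriple.tripleSum q x y z)) := by
  have hq1 : ‖q‖ < 1 := hqx.trans hx
  have hx0 : x ≠ 0 := norm_pos_iff.mp ((norm_nonneg _).trans_lt hqx)
  have hy0 : y ≠ 0 := norm_pos_iff.mp ((norm_nonneg _).trans_lt hqy)
  have hz0 : z ≠ 0 := norm_pos_iff.mp ((norm_nonneg _).trans_lt hqz)
  refine ⟨?_, ?_, ?_, ?_⟩
  · rw [← nonnegEquiv.summable_iff]
    exact (summable_natTerm hq1 hx hy hz).congr fun p ↦ (term_nonnegEquiv q x y z p).symm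
  · rw [← negEquiv.summable_iff]
    exact ((summable_natTerm hq1 (norm_div_lt_one (norm_sq_lt hq1 hqx))
      (norm_div_lt_one (norm_sq_lt hq1 hqy)) (norm_div_lt_one (norm_sq_lt hq1 hqz))).mul_left
      (q ^ 3 / (x * y * z))).congr fun p ↦ (term_negEquiv hx0 hy0 hz0 p).symm
  · rintro ⟨hxy, hxz, hyz⟩
    rw [tripleSum_eq_heckeSum hq1 hqx hx hqy hy hqz hz,
      heckeSum_eq_appellLerchSide hq1 hq hqx hx hqy hy hqz hz hxy hxz hyz]
  · refine ((continuousAt_tripleSum hq1 hqx hx hqy hy hqz hz).tendsto.mono_left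
      nhdsWithin_le_nhds).congr' ?_
    have hU : annulus ‖q‖ 1 ×ˢ (annulus ‖q‖ 1 ×ˢ annulus ‖q‖ 1) ∈ 𝓝 (x, y, z) :=
      ((isOpen_annulus _ _).prod ((isOpen_annulus _ _).prod (isOpen_annulus _ _))).mem_nhds
        ⟨⟨hqx, hx⟩, ⟨hqy, hy⟩, ⟨hqz, hz⟩⟩
    filter_upwards [self_mem_nhdsWithin, nhdsWithin_le_nhds hU] with p hp hpU
    obtain ⟨⟨h1, h2⟩, ⟨h3, h4⟩, ⟨h5, h6⟩⟩ := hpU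
    obtain ⟨hxy, hxz, hyz⟩ := hp
    rw [tripleSum_eq_heckeSum hq1 h1 h2 h3 h4 h5 h6,
      heckeSum_eq_appellLerchSide hq1 hq h1 h2 h3 h4 h5 h6 hxy hxz hyz]
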